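/- Setting. Let $\mathcal H$ be a smooth $m$-dimensional manifold, $\gamma$ and $Y$ smooth symmetric two-covariant tensor fields, $\ell$ a smooth one-form and $\ell^{(2)}$ a smooth function on $\mathcal H$. The tuple $\mathcal D=\{\mathcal H,\gamma,\ell,\ell^{(2)},Y\}$ is *hypersurface data* if the symmetric bilinear form $\mathcal A|_p((W,a),(Z,b))=\gamma(W,Z)+a\,\ell(Z)+b\,\ell(W)+ab\,\ell^{(2)}$ on $T_p\mathcal H\times\mathbb R$ is non-degenerate at every $p$. Its inverse $\mathcal A^\sharp$ defines a symmetric two-contravariant tensor $P$, a vector field $n$ and a function $n^{(2)}$ by $$\mathcal A^\sharp((\alpha,a),(\beta,b))=P(\alpha,\beta)+a\,n(\beta)+b\,n(\alpha)+ab\,n^{(2)}.$$ Put $K=n^{(2)}Y+\tfrac12\mathcal L_n\gamma+\ell\otimes_s dn^{(2)}$ and $F=\tfrac12 d\ell$, where $\alpha\otimes_s\beta=\frac12(\alpha\otimes\beta+\beta\otimes\alpha)$. Let $\overline\nabla$ be the unique torsion-free connection with $$(\overline\nabla_X\gamma)(Z,W)=-\ell(Z)K(X,W)-\ell(W)K(X,Z),\qquad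 (\overline\nabla_X\ell)(Z)=Y(X,Z)+F(X,Z)-\ell^{(2)}K(X,Z),$$ and let $\overline R^f{}_{bcd}$ be its curvature, $\overline R(\partial_c,\partial_d)\partial_b=\overline R^f{}_{bcd}\,\partial_f$. With brackets denoting antisymmetrization with weight $\tfrac12$, define $$A_{bcd}=\ell_a\overline R^a{}_{bcd}+2\ell^{(2)}\overline\nabla_{[d}K_{c]b}+K_{b[c}\overline\nabla_{d]}\ell^{(2)},$$ $$B_{abcd}=\gamma_{af}\overline R^f{}_{bcd}+2\overline\nabla_{[d}(K_{c]b}\ell_a)+2\ell^{(2)}K_{b[c}K_{d]a},$$ $$\mathcal R_{ab}=B_{acbd}P^{cd}-(A_{bac}+A_{abc})n^c,\qquad H=-\tfrac12P^{ab}\mathcal R_{ab},\qquad J_b=\mathcal R_{ab}n^a .$$ The data is *characteristic hypersurface data* if (1) at every point $\gamma$ has non-trivial radical and is positive semi-definite; (2) there is a smooth function $u$ on $\mathcal H$ such that $n(u)$ vanishes nowhere; and (3) the (non-empty) level sets of $u$ are all diffeomorphic to each other. For a smooth nowhere vanishing function $z$ and a smooth vector field $\zeta$ on $\mathcal H$,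 the *gauge transformed* data $\mathcal D'=\mathcal G_{(z,\zeta)}\mathcal D$ is $$\gamma'=\gamma,\quad \ell'=z(\ell+\gamma(\zeta,\cdot)),\quad \ell'^{(2)}=z^2\big(\ell^{(2)}+2\ell(\zeta)+\gamma(\zeta,\zeta)\big),\quad Y'=zY+\ell\otimes_s dz+\tfrac12\mathcal L_{z\zeta}\gamma .$$ Theorem. Let $\mathcal D$ be characteristic hypersurface data, let $z$ be a smooth nowhere vanishing function and $\zeta$ a smooth vector field on $\mathcal H$, and let primes denote the tensors constructed from $\mathcal D'=\mathcal G_{(z,\zeta)}\mathcal D$. Then, on all of $\mathcal H$, 1. $H'=H+\zeta^aJ_a$; 2. $J'_a=z^{-1}J_a$; 3. $\mathcal R'_{ab}=\mathcal R_{ab}$. -/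

import Mathlib

open scoped Manifold ContDiff
open Bundle

noncomputable section

namespace NullHypersurface

/-! ## Tensor calculus in one coordinate chart -/

/-- The model space `ℝ^m`. -/
abbrev Model (m : ℕ) : Type := EuclideanSpace ℝ (Fin m)

/-- The `a`-th partial derivative of `f` at `x`. -/
def pd {m : ℕ} (a : Fin m) (f : Model m → ℝ) (x : Model m) : ℝ :=
  fderiv ℝ f x (EuclideanSpace.single a 1)

/-- The coordinate components, in one chart, of the tensors `γ_ab`, `ℓ_a`, `ℓ⁽²⁾`, `Y_ab` of
hypersurface data and of the associated contravariant objects `P^{ab}`, `n^a`, `n⁽²⁾`. -/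
structure Components (m : ℕ) where
  γ : Model m → Fin m → Fin m → ℝ
  ℓ : Model m → Fin m → ℝ
  ℓ2 : Model m → ℝ
  Y : Model m → Fin m → Fin m → ℝ
  P : Model m → Fin m → Fin m → ℝ
  n : Model m → Fin m → ℝ
  n2 : Model m → ℝ

namespace Components

variable {m : ℕ} (C : Components m)

/-- `K = n⁽²⁾ Y + ½ 𝓛_n γ + ℓ ⊗ₛ dn⁽²⁾`. -/
def K (x : Model m) (a b : Fin m) : ℝ :=
  C.n2 x * C.Y x a b
    + (1 / 2) * ∑ c, (C.n x c * pd c (fun y => C.γ y a b) x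
        + C.γ x c b * pd a (fun y => C.n y c) x
        + C.γ x a c * pd b (fun y => C.n y c) x)
    + (1 / 2) * (C.ℓ x a * pd b C.n2 x + C.ℓ x b * pd a C.n2 x)

/-- `F = ½ dℓ`. -/
def F (x : Model m) (a b : Fin m) : ℝ :=
  (1 / 2) * (pd a (fun y => C.ℓ y b) x - pd b (fun y => C.ℓ y a) x)

/-- The connection coefficients `Γ^c_{ab}` of the connection `∇̄` of the data. The lemma
`isConnection_iff` shows that they are the only solution of the equations that define `∇̄`. -/
def Γ (x : Model m) (c a b : Fin m) : ℝ :=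
  (∑ d, C.P x c d * ((1 / 2) * (pd a (fun y => C.γ y b d) x + pd b (fun y => C.γ y a d) x
      - pd d (fun y => C.γ y a b) x) + C.K x a b * C.ℓ x d))
    + C.n x c * ((1 / 2) * (pd a (fun y => C.ℓ y b) x + pd b (fun y => C.ℓ y a) x)
      - C.Y x a b + C.ℓ2 x * C.K x a b)

/-- The curvature `R^f_{bcd}` of `∇̄`, that is, `R̄(∂_c, ∂_d) ∂_b = R^f_{bcd} ∂_f`. -/
def Riem (x : Model m) (f b c d : Fin m) : ℝ :=
  pd c (fun y => C.Γ y f d b) x - pd d (fun y => C.Γ y f c b) x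
    + ∑ e, (C.Γ x f c e * C.Γ x e d b - C.Γ x f d e * C.Γ x e c b)

/-- `∇̄_a T_{bc}` for a two-covariant tensor `T`. -/
def nabla₂ (T : Model m → Fin m → Fin m → ℝ) (x : Model m) (a b c : Fin m) : ℝ :=
  pd a (fun y => T y b c) x - ∑ e, (C.Γ x e a b * T x e c + C.Γ x e a c * T x b e)

/-- `∇̄_a T_{bcd}` for a three-covariant tensor `T`. -/
def nabla₃ (T : Model m → Fin m → Fin m → Fin m → ℝ) (x : Model m) (a b c d : Fin m) : ℝ :=
  pd a (fun y => T y b c d) x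
    - ∑ e, (C.Γ x e a b * T x e c d + C.Γ x e a c * T x b e d + C.Γ x e a d * T x b c e)

/-- `A_{bcd} = ℓ_a R^a_{bcd} + 2 ℓ⁽²⁾ ∇̄_{[d} K_{c]b} + K_{b[c} ∇̄_{d]} ℓ⁽²⁾`. -/
def A (x : Model m) (b c d : Fin m) : ℝ :=
  (∑ a, C.ℓ x a * C.Riem x a b c d)
    + 2 * C.ℓ2 x * ((1 / 2) * (C.nabla₂ C.K x d c b - C.nabla₂ C.K x c d b))
    + (1 / 2) * (C.K x b c * pd d C.ℓ2 x - C.K x b d * pd c C.ℓ2 x)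

/-- `B_{abcd} = γ_{af} R^f_{bcd} + 2 ∇̄_{[d} (K_{c]b} ℓ_a) + 2 ℓ⁽²⁾ K_{b[c} K_{d]a}`. -/
def B (x : Model m) (a b c d : Fin m) : ℝ :=
  (∑ f, C.γ x a f * C.Riem x f b c d)
    + 2 * ((1 / 2) * (C.nabla₃ (fun y i j k => C.K y i j * C.ℓ y k) x d c b a
        - C.nabla₃ (fun y i j k => C.K y i j * C.ℓ y k) x c d b a))
    + 2 * C.ℓ2 x * ((1 / 2) * (C.K x b c * C.K x d a - C.K x b d * C.K x c a))

/-- The constraint tensor `𝓡_{ab} = B_{acbd} P^{cd} - (A_{bac} + A_{abc}) n^c`. -/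
def Ric (x : Model m) (a b : Fin m) : ℝ :=
  (∑ c, ∑ d, C.B x a c b d * C.P x c d) - ∑ c, (C.A x b a c + C.A x a b c) * C.n x c

/-- `H = -½ P^{ab} 𝓡_{ab}`. -/
def H (x : Model m) : ℝ := -(1 / 2) * ∑ a, ∑ b, C.P x a b * C.Ric x a b

/-- `J_b = 𝓡_{ab} n^a`. -/
def J (x : Model m) (b : Fin m) : ℝ := ∑ a, C.Ric x a b * C.n x a

/-- `G^c_{ab}` are, at `x`, the coefficients of a torsion-free connection with
`∇_a γ_{bd} = - ℓ_b K_{ad} - ℓ_d K_{ab}` and `∇_a ℓ_b = Y_{ab} + F_{ab} - ℓ⁽²⁾ K_{ab}`. -/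
def IsConnection (x : Model m) (G : Fin m → Fin m → Fin m → ℝ) : Prop :=
  (∀ c a b, G c a b = G c b a) ∧
  (∀ a b d, pd a (fun y => C.γ y b d) x - ∑ e, (G e a b * C.γ x e d + G e a d * C.γ x b e)
    = - C.ℓ x b * C.K x a d - C.ℓ x d * C.K x a b) ∧
  (∀ a b, pd a (fun y => C.ℓ y b) x - ∑ e, G e a b * C.ℓ x e
    = C.Y x a b + C.F x a b - C.ℓ2 x * C.K x a b)

/-- If the components come from hypersurface data, `Γ` is the only solution of the equations
that define `∇̄`. -/
theorem isConnection_iff (x : Model m) (G : Fin m → Fin m → Fin m → ℝ)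
    (γs : ∀ y a b, C.γ y a b = C.γ y b a) (Ys : ∀ y a b, C.Y y a b = C.Y y b a)
    (Ps : ∀ y a b, C.P y a b = C.P y b a)
    (γn : ∀ᶠ y in nhds x, ∀ a, ∑ b, C.γ y a b * C.n y b + C.n2 y * C.ℓ y a = 0)
    (ℓn : ∑ a, C.ℓ x a * C.n x a + C.n2 x * C.ℓ2 x = 1)
    (Pℓ : ∀ a, ∑ b, C.P x a b * C.ℓ x b + C.ℓ2 x * C.n x a = 0)
    (Pγ : ∀ a c, ∑ b, C.P x a b * C.γ x b c + C.n x a * C.ℓ x c = if a = c then 1 else 0)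
    (dγ : ∀ a b, DifferentiableAt ℝ (fun y => C.γ y a b) x)
    (dℓ : ∀ a, DifferentiableAt ℝ (fun y => C.ℓ y a) x)
    (dn : ∀ a, DifferentiableAt ℝ (fun y => C.n y a) x)
    (dn2 : DifferentiableAt ℝ C.n2 x) :
    C.IsConnection x G ↔ G = C.Γ x := by
  have γs' : ∀ a b, (fun y => C.γ y a b) = fun y => C.γ y b a := fun a b => by
    funext y; exact γs y a b
  have Ks : ∀ a b, C.K x a b = C.K x b a := by
    intro a b
    unfold K
    rw [γs' a b, Ys x a b]
    congr 1
    · congr 2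
      refine Finset.sum_congr rfl fun c _ => ?_
      rw [γs x c b, γs x a c]; ring
    · ring
  -- the derivative of `γ_{ab} n^b + n⁽²⁾ ℓ_a = 0`
  have dγn : ∀ c a, (∑ b, (C.γ x a b * pd c (fun y => C.n y b) x
      + pd c (fun y => C.γ y a b) x * C.n x b))
      + (C.n2 x * pd c (fun y => C.ℓ y a) x + pd c C.n2 x * C.ℓ x a) = 0 := by
    intro c a
    have h0 : (fun y => ∑ b, C.γ y a b * C.n y b + C.n2 y * C.ℓ y a) =ᶠ[nhds x] fun _ => 0 :=
      γn.mono fun y hy => hy a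
    have h1 := h0.fderiv_eq (𝕜 := ℝ)
    have h4 : HasFDerivAt (fun y => ∑ b, C.γ y a b * C.n y b)
        (∑ b, (C.γ x a b • fderiv ℝ (fun y => C.n y b) x
          + C.n x b • fderiv ℝ (fun y => C.γ y a b) x)) x :=
      HasFDerivAt.fun_sum fun b _ => (dγ a b).hasFDerivAt.mul (dn b).hasFDerivAt
    have h2 := h4.add (dn2.hasFDerivAt.mul (dℓ a).hasFDerivAt)
    change fderiv ℝ ((fun y => ∑ b, C.γ y a b * C.n y b) + (C.n2 * fun y => C.ℓ y a)) x = _ at h1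
    rw [h2.fderiv] at h1
    have h3 := congrArg (fun L : Model m →L[ℝ] ℝ => L (EuclideanSpace.single c 1)) h1
    simp only [add_apply, sum_apply,
      smul_apply, smul_eq_mul, fderiv_fun_const, Pi.zero_apply,
      zero_apply] at h3
    rw [← h3]
    unfold pd
    congr 1
    · exact Finset.sum_congr rfl fun b _ => by ring
    · ring
  set S : Fin m → Fin m → Fin m → ℝ := fun d a b =>
    (1 / 2) * (pd a (fun y => C.γ y b d) x + pd b (fun y => C.γ y a d) x
      - pd d (fun y => C.γ y a b) x) + C.K x a b * C.ℓ x d with hS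
  set T : Fin m → Fin m → ℝ := fun a b =>
    (1 / 2) * (pd a (fun y => C.ℓ y b) x + pd b (fun y => C.ℓ y a) x)
      - C.Y x a b + C.ℓ2 x * C.K x a b with hT
  have hΓ : ∀ c a b, C.Γ x c a b = ∑ d, C.P x c d * S d a b + C.n x c * T a b :=
    fun c a b => rfl
  have nS : ∀ a b, ∑ d, C.n x d * S d a b + C.n2 x * T a b = 0 := by
    intro a b
    have e1 : ∑ d, C.n x d * S d a b =
        (1 / 2) * (∑ d, pd a (fun y => C.γ y b d) x * C.n x d
          + ∑ d, pd b (fun y => C.γ y a d) x * C.n x d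
          - ∑ d, C.n x d * pd d (fun y => C.γ y a b) x)
        + C.K x a b * ∑ d, C.ℓ x d * C.n x d := by
      simp only [hS, Finset.mul_sum, ← Finset.sum_add_distrib, ← Finset.sum_sub_distrib]
      exact Finset.sum_congr rfl fun d _ => by ring
    have h1 := dγn a b
    have h2 := dγn b a
    rw [Finset.sum_add_distrib] at h1 h2
    have hK : C.K x a b = C.n2 x * C.Y x a b
        + (1 / 2) * (∑ d, C.n x d * pd d (fun y => C.γ y a b) x
          + ∑ d, C.γ x b d * pd a (fun y => C.n y d) x
          + ∑ d, C.γ x a d * pd b (fun y => C.n y d) x)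
        + (1 / 2) * (C.ℓ x a * pd b C.n2 x + C.ℓ x b * pd a C.n2 x) := by
      unfold K
      rw [Finset.sum_add_distrib, Finset.sum_add_distrib]
      simp only [γs x b]
    rw [e1]
    simp only [hT]
    linear_combination hK + (1 / 2) * h1 + (1 / 2) * h2 + C.K x a b * ℓn
  have γΓ : ∀ e a b, ∑ c, C.γ x c e * C.Γ x c a b = S e a b := by
    intro e a b
    have e1 : ∑ c, C.γ x c e * C.Γ x c a b =
        ∑ d, (∑ c, C.P x d c * C.γ x c e) * S d a b
          + (∑ c, C.γ x e c * C.n x c) * T a b := by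
      simp only [hΓ, mul_add, Finset.sum_add_distrib, Finset.mul_sum, Finset.sum_mul]
      rw [Finset.sum_comm]
      congr 1
      · exact Finset.sum_congr rfl fun d _ => Finset.sum_congr rfl fun c _ => by
          rw [Ps x d c]; ring
      · exact Finset.sum_congr rfl fun c _ => by rw [γs x e c]; ring
    have e2 : ∀ d, (∑ c, C.P x d c * C.γ x c e) * S d a b =
        (if d = e then S d a b else 0) - C.ℓ x e * (C.n x d * S d a b) := by
      intro d
      have := Pγ d e
      rw [eq_sub_of_add_eq this]
      split_ifs <;> ring
    rw [e1, Finset.sum_congr rfl fun d _ => e2 d, Finset.sum_sub_distrib, ← Finset.mul_sum,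
      eq_neg_of_add_eq_zero_left (γn.self_of_nhds e)]
    simp only [Finset.sum_ite_eq', Finset.mem_univ, if_true]
    linear_combination -C.ℓ x e * nS a b
  have ℓΓ : ∀ a b, ∑ c, C.ℓ x c * C.Γ x c a b = T a b := by
    intro a b
    have e1 : ∑ c, C.ℓ x c * C.Γ x c a b =
        ∑ d, (∑ c, C.P x d c * C.ℓ x c) * S d a b + (∑ c, C.ℓ x c * C.n x c) * T a b := by
      simp only [hΓ, mul_add, Finset.sum_add_distrib, Finset.mul_sum, Finset.sum_mul]
      rw [Finset.sum_comm]
      congr 1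
      · exact Finset.sum_congr rfl fun d _ => Finset.sum_congr rfl fun c _ => by
          rw [Ps x d c]; ring
      · exact Finset.sum_congr rfl fun c _ => by ring
    have e2 : ∀ d, (∑ c, C.P x d c * C.ℓ x c) * S d a b =
        - C.ℓ2 x * (C.n x d * S d a b) := by
      intro d
      rw [eq_neg_of_add_eq_zero_left (Pℓ d)]; ring
    rw [e1, Finset.sum_congr rfl fun d _ => e2 d, ← Finset.mul_sum]
    linear_combination T a b * ℓn - C.ℓ2 x * nS a b
  have Ss : ∀ d a b, S d a b = S d b a := by
    intro d a b
    simp only [hS]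
    rw [γs' a b, Ks a b]; ring
  have Ts : ∀ a b, T a b = T b a := by
    intro a b
    simp only [hT]
    rw [Ys x a b, Ks a b]; ring
  constructor
  · rintro ⟨h1, h2, h3⟩
    have γG : ∀ e a b, ∑ c, C.γ x c e * G c a b = S e a b := by
      intro e a b
      have k1 := h2 a b e
      have k2 := h2 b a e
      have k3 := h2 e a b
      rw [Finset.sum_add_distrib] at k1 k2 k3
      have r1 : ∑ c, G c b a * C.γ x c e = ∑ c, G c a b * C.γ x c e :=
        Finset.sum_congr rfl fun c _ => by rw [h1]
      have r2 : ∑ c, G c e a * C.γ x c b = ∑ c, G c a e * C.γ x b c :=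
        Finset.sum_congr rfl fun c _ => by rw [h1, γs]
      have r3 : ∑ c, G c e b * C.γ x a c = ∑ c, G c b e * C.γ x a c :=
        Finset.sum_congr rfl fun c _ => by rw [h1]
      rw [Finset.sum_congr rfl fun c _ => mul_comm (C.γ x c e) (G c a b)]
      simp only [hS]
      rw [Ks e a, Ks e b] at k3
      rw [Ks b a] at k2
      linear_combination (-1 / 2) * k1 + (-1 / 2) * k2 + (1 / 2) * k3 - (1 / 2) * r1
        + (1 / 2) * r2 + (1 / 2) * r3
    have ℓG : ∀ a b, ∑ c, C.ℓ x c * G c a b = T a b := by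
      intro a b
      have k := h3 a b
      rw [Finset.sum_congr rfl fun c _ => mul_comm (C.ℓ x c) (G c a b)]
      simp only [hT]
      unfold F at k
      linear_combination -k
    funext c a b
    have e1 : G c a b = ∑ e, (if c = e then 1 else 0) * G e a b := by simp
    rw [e1, hΓ]
    simp only [← Pγ, ← γG, ← ℓG, Finset.mul_sum, add_mul, Finset.sum_mul,
      Finset.sum_add_distrib]
    rw [Finset.sum_comm]
    congr 1
    · exact Finset.sum_congr rfl fun d _ => Finset.sum_congr rfl fun e _ => by
        rw [γs x e d]; ring
    · exact Finset.sum_congr rfl fun e _ => by ring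
  · rintro rfl
    refine ⟨fun c a b => ?_, fun a b d => ?_, fun a b => ?_⟩
    · rw [hΓ, hΓ, Ts a b]
      congr 1
      exact Finset.sum_congr rfl fun d _ => by rw [Ss d a b]
    · have k1 := γΓ d a b
      have k2 := γΓ b a d
      rw [Finset.sum_add_distrib]
      have r1 : ∑ e, C.Γ x e a b * C.γ x e d = S d a b := by
        rw [← k1]; exact Finset.sum_congr rfl fun e _ => by ring
      have r2 : ∑ e, C.Γ x e a d * C.γ x b e = S b a d := by
        rw [← k2]; exact Finset.sum_congr rfl fun e _ => by rw [γs x b e]; ring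
      rw [r1, r2]
      simp only [hS]
      rw [γs' d b]
      ring
    · have r1 : ∑ e, C.Γ x e a b * C.ℓ x e = T a b := by
        rw [← ℓΓ a b]; exact Finset.sum_congr rfl fun e _ => by ring
      rw [r1]
      simp only [hT, F]
      ring

end Components

/-! ## Hypersurface data on a manifold -/

/-- The tensors `γ`, `ℓ`, `ℓ⁽²⁾`, `Y` on a manifold `M` of dimension `m`. -/
structure Tensors (m : ℕ) (M : Type*) [TopologicalSpace M] [ChartedSpace (Model m) M] where
  γ : ∀ p : M, TangentSpace (𝓡 m) p →L[ℝ] TangentSpace (𝓡 m) p →L[ℝ] ℝ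
  ℓ : ∀ p : M, TangentSpace (𝓡 m) p →L[ℝ] ℝ
  ℓ2 : M → ℝ
  Y : ∀ p : M, TangentSpace (𝓡 m) p →L[ℝ] TangentSpace (𝓡 m) p →L[ℝ] ℝ

variable {m : ℕ} {M : Type*} [TopologicalSpace M] [ChartedSpace (Model m) M]

/-- Smoothness of a vector field. -/
def SmoothVectorField [IsManifold (𝓡 m) ∞ M] (X : ∀ p : M, TangentSpace (𝓡 m) p) : Prop :=
  ContMDiff (𝓡 m) ((𝓡 m).prod 𝓘(ℝ, Model m)) ∞
    (fun p : M => TotalSpace.mk' (Model m) p (X p))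

/-- Smoothness of a one-form. -/
def SmoothOneForm [IsManifold (𝓡 m) ∞ M] (α : ∀ p : M, TangentSpace (𝓡 m) p →L[ℝ] ℝ) : Prop :=
  ContMDiff (𝓡 m) ((𝓡 m).prod 𝓘(ℝ, Model m →L[ℝ] ℝ)) ∞
    (fun p : M => TotalSpace.mk' (Model m →L[ℝ] ℝ)
      (E := fun q : M => TangentSpace (𝓡 m) q →L[ℝ] ℝ) p (α p))

/-- Smoothness of a two-covariant tensor field. -/
def SmoothForm₂ [IsManifold (𝓡 m) ∞ M]
    (T : ∀ p : M, TangentSpace (𝓡 m) p →L[ℝ] TangentSpace (𝓡 m) p →L[ℝ] ℝ) : Prop :=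
  ContMDiff (𝓡 m) ((𝓡 m).prod 𝓘(ℝ, Model m →L[ℝ] Model m →L[ℝ] ℝ)) ∞
    (fun p : M => TotalSpace.mk' (Model m →L[ℝ] Model m →L[ℝ] ℝ)
      (E := fun q : M => TangentSpace (𝓡 m) q →L[ℝ] TangentSpace (𝓡 m) q →L[ℝ] ℝ) p (T p))

/-- The pull-back `(v, w) ↦ T (f v) (f w)` of a bilinear form. -/
def pullForm {V W : Type*} [AddCommGroup V] [Module ℝ V] [TopologicalSpace V]
    [IsTopologicalAddGroup V] [ContinuousConstSMul ℝ V]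
    [AddCommGroup W] [Module ℝ W] [TopologicalSpace W]
    [IsTopologicalAddGroup W] [ContinuousConstSMul ℝ W]
    (f : V →L[ℝ] W) (T : W →L[ℝ] W →L[ℝ] ℝ) : V →L[ℝ] V →L[ℝ] ℝ :=
  (ContinuousLinearMap.precomp ℝ f).comp (T.comp f)

/-- The coordinate vector field `∂_a` of the chart `e` at the point with coordinates `x`. -/
def coordVec (e : OpenPartialHomeomorph M (Model m)) (x : Model m) (a : Fin m) :
    TangentSpace (𝓡 m) (e.symm x) :=
  mfderiv 𝓘(ℝ, Model m) (𝓡 m) e.symm x (EuclideanSpace.single a (1 : ℝ) : Model m)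

/-- The differential of the chart `e` at the point with coordinates `x`. -/
def chartDeriv (e : OpenPartialHomeomorph M (Model m)) (x : Model m) :
    TangentSpace (𝓡 m) (e.symm x) →L[ℝ] Model m :=
  mfderiv (𝓡 m) 𝓘(ℝ, Model m) e (e.symm x)

/-- The coordinate one-form `dx^a` of the chart `e` at the point with coordinates `x`. -/
def coordForm (e : OpenPartialHomeomorph M (Model m)) (x : Model m) (a : Fin m) :
    TangentSpace (𝓡 m) (e.symm x) →L[ℝ] ℝ :=
  (EuclideanSpace.proj a : Model m →L[ℝ] ℝ).comp (chartDeriv e x)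

/-- The Lie derivative `𝓛_X T` of a two-covariant tensor field, computed at `p` in the preferred
chart at `p`: `(𝓛_X T)(v, w) = (D_X T)(v, w) + T(D_v X, w) + T(v, D_w X)`. -/
def lieDerivative (X : ∀ p : M, TangentSpace (𝓡 m) p)
    (T : ∀ p : M, TangentSpace (𝓡 m) p →L[ℝ] TangentSpace (𝓡 m) p →L[ℝ] ℝ) (p : M) :
    TangentSpace (𝓡 m) p →L[ℝ] TangentSpace (𝓡 m) p →L[ℝ] ℝ :=
  let e : OpenPartialHomeomorph M (Model m) := chartAt (Model m) p
  let That : Model m → (Model m →L[ℝ] Model m →L[ℝ] ℝ) := fun x =>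
    pullForm (mfderiv 𝓘(ℝ, Model m) (𝓡 m) e.symm x : Model m →L[ℝ] TangentSpace (𝓡 m) (e.symm x))
      (T (e.symm x))
  let Xhat : Model m → Model m := fun x => chartDeriv e x (X (e.symm x))
  let DX : Model m →L[ℝ] Model m := fderiv ℝ Xhat (e p)
  let L : Model m →L[ℝ] Model m →L[ℝ] ℝ :=
    fderiv ℝ That (e p) (Xhat (e p)) + (That (e p)).comp DX
      + (ContinuousLinearMap.precomp ℝ DX).comp (That (e p))
  pullForm (mfderiv (𝓡 m) 𝓘(ℝ, Model m) e p : TangentSpace (𝓡 m) p →L[ℝ] Model m) L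

/-- The differential of a function, as a one-form. -/
def diff (f : M → ℝ) (p : M) : TangentSpace (𝓡 m) p →L[ℝ] ℝ := mfderiv (𝓡 m) 𝓘(ℝ, ℝ) f p

/-- The symmetrized tensor product `α ⊗ₛ β = ½ (α ⊗ β + β ⊗ α)` of two covectors. -/
def symProd {V : Type*} [AddCommGroup V] [Module ℝ V] [TopologicalSpace V]
    [IsTopologicalAddGroup V] [ContinuousConstSMul ℝ V]
    (α β : V →L[ℝ] ℝ) : V →L[ℝ] V →L[ℝ] ℝ :=
  (1 / 2 : ℝ) • (α.smulRight β + β.smulRight α)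

/-- Two subsets (in the use below: embedded submanifolds) of `M` are diffeomorphic: there are
mutually inverse maps between them, both smooth on the respective subset. -/
def DiffeomorphicSubsets (m : ℕ) {M : Type*} [TopologicalSpace M] [ChartedSpace (Model m) M]
    (S T : Set M) : Prop :=
  ∃ f g : M → M, Set.MapsTo f S T ∧ Set.MapsTo g T S ∧ Set.LeftInvOn g f S ∧ Set.RightInvOn g f T ∧
    ContMDiffOn (𝓡 m) (𝓡 m) ∞ f S ∧ ContMDiffOn (𝓡 m) (𝓡 m) ∞ g T

namespace Tensors

variable (D : Tensors m M)

/-- The bilinear form `𝓐_p((W,a),(Z,b)) = γ(W,Z) + a ℓ(Z) + b ℓ(W) + a b ℓ⁽²⁾` on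
`T_p M × ℝ`. -/
def 𝓐 (p : M) : LinearMap.BilinForm ℝ (TangentSpace (𝓡 m) p × ℝ) :=
  LinearMap.mk₂ ℝ
    (fun V W => D.γ p V.1 W.1 + V.2 * D.ℓ p W.1 + W.2 * D.ℓ p V.1 + V.2 * W.2 * D.ℓ2 p)
    (by intro V V' W; simp; ring) (by intro c V W; simp; ring)
    (by intro V W W'; simp; ring) (by intro c V W; simp; ring)

/-- For non-degenerate `𝓐_p`: the vector `V` with `𝓐_p(V, ·) = φ`; see `𝓐_raise`. -/
def raise (p : M) (φ : Module.Dual ℝ (TangentSpace (𝓡 m) p × ℝ)) : TangentSpace (𝓡 m) p × ℝ :=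
  Function.invFun (D.𝓐 p) φ

theorem 𝓐_raise (p : M) (h : (D.𝓐 p).Nondegenerate)
    (φ : Module.Dual ℝ (TangentSpace (𝓡 m) p × ℝ)) : D.𝓐 p (D.raise p φ) = φ := by
  have : FiniteDimensional ℝ (TangentSpace (𝓡 m) p) :=
    inferInstanceAs (FiniteDimensional ℝ (Model m))
  refine Function.invFun_eq ⟨((D.𝓐 p).toDual h).symm φ, ?_⟩
  refine LinearMap.ext fun W => ?_
  rw [← LinearMap.BilinForm.toDual_def h, LinearEquiv.apply_symm_apply]

/-- The vector `𝓐^♯((α, a), ·)` of `T_p M × ℝ`, where the covector `(α, a)` acts by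
`(W, b) ↦ α(W) + a b`. -/
def sharp (p : M) (α : TangentSpace (𝓡 m) p →L[ℝ] ℝ) (a : ℝ) : TangentSpace (𝓡 m) p × ℝ :=
  D.raise p ((α : TangentSpace (𝓡 m) p →ₗ[ℝ] ℝ).coprod (a • LinearMap.id))

/-- `P(α, β) = 𝓐^♯((α, 0), (β, 0))`. -/
def P (p : M) (α β : TangentSpace (𝓡 m) p →L[ℝ] ℝ) : ℝ := β (D.sharp p α 0).1

/-- The vector `n`, with `β(n) = 𝓐^♯((0, 1), (β, 0))`. -/
def n (p : M) : TangentSpace (𝓡 m) p := (D.sharp p 0 1).1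

/-- `n⁽²⁾ = 𝓐^♯((0, 1), (0, 1))`. -/
def n2 (p : M) : ℝ := (D.sharp p 0 1).2

/-- Hypersurface data: smooth tensors, with `γ` and `Y` symmetric and `𝓐` non-degenerate. -/
structure IsHypersurfaceData [IsManifold (𝓡 m) ∞ M] : Prop where
  smooth_γ : SmoothForm₂ D.γ
  smooth_ℓ : SmoothOneForm D.ℓ
  smooth_ℓ2 : ContMDiff (𝓡 m) 𝓘(ℝ, ℝ) ∞ D.ℓ2
  smooth_Y : SmoothForm₂ D.Y
  symm_γ : ∀ p v w, D.γ p v w = D.γ p w v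
  symm_Y : ∀ p v w, D.Y p v w = D.Y p w v
  nondegenerate : ∀ p, (D.𝓐 p).Nondegenerate

/-- `u` is a foliation function: `u` is smooth and `n(u)` vanishes nowhere. -/
def IsFoliationFunction (u : M → ℝ) : Prop :=
  ContMDiff (𝓡 m) 𝓘(ℝ, ℝ) ∞ u ∧ ∀ p, diff (m := m) u p (D.n p) ≠ 0

/-- Characteristic hypersurface data. -/
structure IsCHD [IsManifold (𝓡 m) ∞ M] : Prop extends D.IsHypersurfaceData where
  rad_ne : ∀ p, ∃ v : TangentSpace (𝓡 m) p, v ≠ 0 ∧ ∀ w, D.γ p v w = 0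
  semipos : ∀ p v, 0 ≤ D.γ p v v
  foliation : ∃ u : M → ℝ, D.IsFoliationFunction u ∧
    ∀ s ∈ Set.range u, ∀ t ∈ Set.range u, DiffeomorphicSubsets m (u ⁻¹' {s}) (u ⁻¹' {t})

/-- The gauge transformed data `𝓖_{(z,ζ)} 𝓓`. -/
def gauge (z : M → ℝ) (ζ : ∀ p : M, TangentSpace (𝓡 m) p) : Tensors m M where
  γ := D.γ
  ℓ p := z p • (D.ℓ p + D.γ p (ζ p))
  ℓ2 p := z p ^ 2 * (D.ℓ2 p + 2 * D.ℓ p (ζ p) + D.γ p (ζ p) (ζ p))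
  Y p := z p • D.Y p + symProd (D.ℓ p) (diff z p)
    + (1 / 2 : ℝ) • lieDerivative (fun q => z q • ζ q) D.γ p

/-- The components of the data in the chart `e`; `x` stands for the point `e.symm x`. -/
def components (e : OpenPartialHomeomorph M (Model m)) : Components m where
  γ x a b := D.γ (e.symm x) (coordVec e x a) (coordVec e x b)
  ℓ x a := D.ℓ (e.symm x) (coordVec e x a)
  ℓ2 x := D.ℓ2 (e.symm x)
  Y x a b := D.Y (e.symm x) (coordVec e x a) (coordVec e x b)
  P x a b := D.P (e.symm x) (coordForm e x a) (coordForm e x b)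
  n x a := coordForm e x a (D.n (e.symm x))
  n2 x := D.n2 (e.symm x)

end Tensors
end NullHypersurface
end

open NullHypersurface

-- The guiding picture is an ambient metric in the frame `(∂_a, ξ)`, with `ξ` a rigging vector: `𝓐`
-- is its Gram matrix, `A` and `B` are the curvature components with `ξ` or `∂_a` in the first slot,
-- and a gauge transformation replaces `ξ` by `z(ξ + ζ)`. No embedding is used; the picture is
-- turned into coordinate identities.
--
-- A non-trivial radical of `γ` forces `n⁽²⁾ = 0` (`n2_eq_zero`). Then `K_ab = -n^c [ab,c]` and
-- `Γ^f_ab = P^{fd} [ab,d] + n^f V_ab`, where `[ab,d]` are the Christoffel symbols of the first kind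
-- of `γ` and `V` is the symmetric derivative of `ℓ` minus `Y`. The covector `G_ab = ([ab,·], V_ab)`
-- plays the role of the lowered ambient derivative of `∂_b` along `∂_a`, and `W_c` that of `ξ`
-- along `∂_c`. With `Q` denoting `𝓐^♯`, the definitions of `A` and `B` collapse to `B_abcd =
-- ∂_c[db,a] - ∂_d[cb,a] - Q(G_ca, G_db) + Q(G_da, G_cb)` and the same formula for `A_bcd` with `V`
-- in place of `[··,a]` and `W` in place of `G_·a` (`IsNull.B_eq`, `IsNull.A_eq`). The first formula
-- shows the Riemann symmetries of `B` that are needed.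
--
-- Under a gauge transformation `[ab,d]` is unchanged, while `G` and `W` change as covectors whose
-- last frame vector becomes `z(ξ + ζ)`. Such a change preserves `Q` (`coform_gaugeCov`). Hence `B'
-- = B` and `A'_bcd = z(A_bcd + ζ^a B_abcd)`. Since `n' = z⁻¹ n` and `P' = P - n⊗ζ - ζ⊗n`, the extra
-- terms in `𝓡'` cancel by antisymmetry and pair symmetry of `B`: `𝓡` is a trace of the curvature,
-- hence independent of the frame. The laws for `J` and `H` follow by contraction, using symmetry of
-- `𝓡` for `H`.
--
-- It remains to pass from the manifold to a chart: the inverse of `𝓐` must have smooth components,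
-- and the Lie derivative, defined in a preferred chart at each point, must have its usual
-- expression in every chart.

noncomputable section

namespace NullHypersurface

variable {m : ℕ}

-- Calculus of partial derivatives on `ℝ^m`.

section PartialDerivatives

variable {f g : Model m → ℝ} {x : Model m} {U : Set (Model m)}

theorem pd_congr (a : Fin m) (h : f =ᶠ[nhds x] g) : pd a f x = pd a g x := by
  unfold pd
  rw [h.fderiv_eq]

theorem pd_congr_on (hU : IsOpen U) (hx : x ∈ U) (a : Fin m) (h : ∀ y ∈ U, f y = g y) :
    pd a f x = pd a g x :=
  pd_congr a (Filter.eventually_of_mem (hU.mem_nhds hx) h)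

theorem pd_const (a : Fin m) (c : ℝ) : pd a (fun _ => c) x = 0 := by
  simp [pd]

theorem pd_add (a : Fin m) (hf : DifferentiableAt ℝ f x) (hg : DifferentiableAt ℝ g x) :
    pd a (fun y => f y + g y) x = pd a f x + pd a g x := by
  unfold pd
  rw [fderiv_fun_add hf hg]
  rfl

theorem pd_sub (a : Fin m) (hf : DifferentiableAt ℝ f x) (hg : DifferentiableAt ℝ g x) :
    pd a (fun y => f y - g y) x = pd a f x - pd a g x := by
  unfold pd
  rw [fderiv_fun_sub hf hg]
  rfl

theorem pd_mul (a : Fin m) (hf : DifferentiableAt ℝ f x) (hg : DifferentiableAt ℝ g x) :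
    pd a (fun y => f y * g y) x = f x * pd a g x + g x * pd a f x := by
  unfold pd
  rw [fderiv_fun_mul hf hg]
  rfl

theorem pd_sum {ι : Type*} (s : Finset ι) {F : ι → Model m → ℝ} (a : Fin m)
    (hF : ∀ i ∈ s, DifferentiableAt ℝ (F i) x) :
    pd a (fun y => ∑ i ∈ s, F i y) x = ∑ i ∈ s, pd a (F i) x := by
  unfold pd
  rw [fderiv_fun_sum hF]
  simp

theorem pd_sum_mul {ι : Type*} (s : Finset ι) {F G : ι → Model m → ℝ} (a : Fin m)
    (hF : ∀ i, DifferentiableAt ℝ (F i) x) (hG : ∀ i, DifferentiableAt ℝ (G i) x) :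
    pd a (fun y => ∑ i ∈ s, F i y * G i y) x
      = ∑ i ∈ s, F i x * pd a (G i) x + ∑ i ∈ s, G i x * pd a (F i) x := by
  rw [pd_sum s a fun i _ => (hF i).fun_mul (hG i), ← Finset.sum_add_distrib]
  exact Finset.sum_congr rfl fun i _ => pd_mul a (hF i) (hG i)

theorem contDiffOn_pd (hU : IsOpen U) (a : Fin m) (hf : ContDiffOn ℝ ∞ f U) :
    ContDiffOn ℝ ∞ (pd a f) U :=
  (hf.fderiv_of_isOpen hU (m := ∞) le_rfl).clm_apply contDiffOn_const

theorem diffAt_of_contDiffOn (hU : IsOpen U) (hx : x ∈ U) (hf : ContDiffOn ℝ ∞ f U) :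
    DifferentiableAt ℝ f x :=
  (hf.contDiffAt (hU.mem_nhds hx)).differentiableAt (by simp)

end PartialDerivatives

-- Connection and curvature in one chart when `n⁽²⁾ = 0`.

namespace Components

/-- The Christoffel symbols `[ab, d]` of the first kind of `γ`. -/
def chr (C : Components m) (x : Model m) (a b d : Fin m) : ℝ :=
  (1 / 2) * (pd a (fun y => C.γ y b d) x + pd b (fun y => C.γ y a d) x
    - pd d (fun y => C.γ y a b) x)

/-- The symmetric derivative of `ℓ` minus `Y`. -/
def V (C : Components m) (x : Model m) (a b : Fin m) : ℝ :=
  (1 / 2) * (pd a (fun y => C.ℓ y b) x + pd b (fun y => C.ℓ y a) x) - C.Y x a b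

/-- The components satisfy, on the open set `U`, the algebraic relations of smooth hypersurface
data with `n⁽²⁾ = 0`. -/
structure IsNull (C : Components m) (U : Set (Model m)) : Prop where
  isOpen : IsOpen U
  symm_γ : ∀ y a b, C.γ y a b = C.γ y b a
  symm_Y : ∀ y ∈ U, ∀ a b, C.Y y a b = C.Y y b a
  symm_P : ∀ y ∈ U, ∀ a b, C.P y a b = C.P y b a
  γ_n : ∀ y ∈ U, ∀ a, ∑ b, C.γ y a b * C.n y b = 0
  ℓ_n : ∀ y ∈ U, ∑ a, C.ℓ y a * C.n y a = 1
  P_ℓ : ∀ y ∈ U, ∀ a, ∑ b, C.P y a b * C.ℓ y b + C.ℓ2 y * C.n y a = 0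
  P_γ : ∀ y ∈ U, ∀ a c, ∑ b, C.P y a b * C.γ y b c + C.n y a * C.ℓ y c = if a = c then 1 else 0
  n2_eq : ∀ y ∈ U, C.n2 y = 0
  smooth_γ : ∀ a b, ContDiffOn ℝ ∞ (fun y => C.γ y a b) U
  smooth_ℓ : ∀ a, ContDiffOn ℝ ∞ (fun y => C.ℓ y a) U
  smooth_ℓ2 : ContDiffOn ℝ ∞ C.ℓ2 U
  smooth_Y : ∀ a b, ContDiffOn ℝ ∞ (fun y => C.Y y a b) U
  smooth_P : ∀ a b, ContDiffOn ℝ ∞ (fun y => C.P y a b) U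
  smooth_n : ∀ a, ContDiffOn ℝ ∞ (fun y => C.n y a) U

namespace IsNull

variable {C : Components m} {U : Set (Model m)} {x : Model m}

theorem smooth_chr (h : C.IsNull U) (a b d : Fin m) : ContDiffOn ℝ ∞ (fun y => C.chr y a b d) U := by
  unfold chr
  exact contDiffOn_const.mul (((contDiffOn_pd h.isOpen a (h.smooth_γ b d)).add
    (contDiffOn_pd h.isOpen b (h.smooth_γ a d))).sub (contDiffOn_pd h.isOpen d (h.smooth_γ a b)))

theorem smooth_V (h : C.IsNull U) (a b : Fin m) : ContDiffOn ℝ ∞ (fun y => C.V y a b) U := by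
  unfold V
  exact (contDiffOn_const.mul ((contDiffOn_pd h.isOpen a (h.smooth_ℓ b)).add
    (contDiffOn_pd h.isOpen b (h.smooth_ℓ a)))).sub (h.smooth_Y a b)

/-- The symmetry of `γ` is assumed on all of `ℝ^m`, so it is an equality of functions and can be
rewritten under `pd`. -/
theorem γ_comm (h : C.IsNull U) (a b : Fin m) : (fun y => C.γ y a b) = fun y => C.γ y b a := by
  funext y; exact h.symm_γ y a b

theorem symm_chr (h : C.IsNull U) (x : Model m) (a b d : Fin m) :
    C.chr x a b d = C.chr x b a d := by
  unfold chr; rw [h.γ_comm a b]; ring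

theorem symm_V (h : C.IsNull U) (hx : x ∈ U) (a b : Fin m) : C.V x a b = C.V x b a := by
  unfold V; rw [h.symm_Y x hx]; ring

theorem pd_γ (h : C.IsNull U) (x : Model m) (c a b : Fin m) :
    pd c (fun y => C.γ y a b) x = C.chr x c a b + C.chr x c b a := by
  unfold chr; rw [h.γ_comm b a]; ring

/-- Since `n⁽²⁾ = 0` on an open set, only `½ 𝓛_n γ` is left of `K`. Differentiating `γ_ab n^b = 0`
moves the derivatives from `n` to `γ` and produces Christoffel symbols. -/
theorem K_eq (h : C.IsNull U) (hx : x ∈ U) (a b : Fin m) :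
    C.K x a b = -∑ c, C.n x c * C.chr x a b c := by
  have hn2 : ∀ c, pd c C.n2 x = 0 := fun c => by
    rw [pd_congr_on (g := fun _ => 0) h.isOpen hx c h.n2_eq, pd_const]
  have key : ∀ c a, ∑ b, C.γ x a b * pd c (fun y => C.n y b) x
      = -∑ b, C.n x b * pd c (fun y => C.γ y a b) x := by
    intro c a
    have h1 : pd c (fun y => ∑ b, C.γ y a b * C.n y b) x = 0 := by
      rw [pd_congr_on (g := fun _ => 0) h.isOpen hx c fun y hy => h.γ_n y hy a, pd_const]
    have dγ := fun b => diffAt_of_contDiffOn h.isOpen hx (h.smooth_γ a b)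
    have dn := fun b => diffAt_of_contDiffOn h.isOpen hx (h.smooth_n b)
    rw [pd_sum_mul _ _ dγ dn] at h1
    linear_combination h1
  have e1 : ∑ c, C.γ x c b * pd a (fun y => C.n y c) x
      = ∑ c, C.γ x b c * pd a (fun y => C.n y c) x :=
    Finset.sum_congr rfl fun c _ => by rw [h.symm_γ]
  unfold K chr
  rw [hn2, hn2, h.n2_eq x hx, Finset.sum_add_distrib, Finset.sum_add_distrib, e1, key, key]
  simp only [mul_add, mul_sub, Finset.sum_add_distrib, Finset.sum_sub_distrib, Finset.mul_sum,
    mul_neg, ← Finset.sum_neg_distrib]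
  simp only [zero_mul, mul_zero, zero_add, add_zero, ← Finset.sum_add_distrib,
    ← Finset.sum_sub_distrib, ← Finset.sum_neg_distrib]
  exact Finset.sum_congr rfl fun c _ => by ring

theorem symm_K (h : C.IsNull U) (hx : x ∈ U) (a b : Fin m) : C.K x a b = C.K x b a := by
  rw [h.K_eq hx, h.K_eq hx]
  exact congrArg _ (Finset.sum_congr rfl fun c _ => by rw [h.symm_chr])

theorem smooth_K (h : C.IsNull U) (a b : Fin m) : ContDiffOn ℝ ∞ (fun y => C.K y a b) U :=
  (ContDiffOn.neg (ContDiffOn.sum fun c _ => (h.smooth_n c).mul (h.smooth_chr a b c))).congr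
    fun _ hy => h.K_eq hy a b

/-- The two terms with `K` cancel because `P^{fd} ℓ_d + ℓ⁽²⁾ n^f = 0`. -/
theorem Γ_eq (h : C.IsNull U) (hx : x ∈ U) (f a b : Fin m) :
    C.Γ x f a b = ∑ d, C.P x f d * C.chr x a b d + C.n x f * C.V x a b := by
  have h1 := h.P_ℓ x hx f
  have e : C.Γ x f a b = ∑ d, C.P x f d * (C.chr x a b d + C.K x a b * C.ℓ x d)
      + C.n x f * (C.V x a b + C.ℓ2 x * C.K x a b) := rfl
  have e2 : ∑ d, C.P x f d * (C.chr x a b d + C.K x a b * C.ℓ x d)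
      = ∑ d, C.P x f d * C.chr x a b d + C.K x a b * ∑ d, C.P x f d * C.ℓ x d := by
    rw [Finset.mul_sum, ← Finset.sum_add_distrib]
    exact Finset.sum_congr rfl fun d _ => by ring
  rw [e, e2]
  linear_combination C.K x a b * h1

theorem symm_Γ (h : C.IsNull U) (hx : x ∈ U) (f a b : Fin m) : C.Γ x f a b = C.Γ x f b a := by
  rw [h.Γ_eq hx, h.Γ_eq hx, h.symm_V hx a b]
  exact congrArg (· + _) (Finset.sum_congr rfl fun d _ => by rw [h.symm_chr])

theorem smooth_Γ (h : C.IsNull U) (f a b : Fin m) : ContDiffOn ℝ ∞ (fun y => C.Γ y f a b) U :=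
  (ContDiffOn.add (ContDiffOn.sum fun d _ => (h.smooth_P f d).mul (h.smooth_chr a b d))
    ((h.smooth_n f).mul (h.smooth_V a b))).congr fun _ hy => h.Γ_eq hy f a b

/-- Lowering with `γ` inverts `P` only up to `-n ⊗ ℓ`; that defect gives the term with `K`, and `γ n
= 0` removes `V`. -/
theorem γ_Γ (h : C.IsNull U) (hx : x ∈ U) (a b c : Fin m) :
    ∑ f, C.γ x a f * C.Γ x f b c = C.chr x b c a + C.K x b c * C.ℓ x a := by
  have e1 : ∑ f, C.γ x a f * C.Γ x f b c
      = ∑ d, (∑ f, C.P x d f * C.γ x f a) * C.chr x b c d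
        + (∑ f, C.γ x a f * C.n x f) * C.V x b c := by
    simp only [h.Γ_eq hx, mul_add, Finset.sum_add_distrib, Finset.mul_sum, Finset.sum_mul]
    rw [Finset.sum_comm]
    refine congrArg₂ _ ?_ ?_
    · exact Finset.sum_congr rfl fun d _ => Finset.sum_congr rfl fun f _ => by
        rw [h.symm_P x hx d f, h.symm_γ x f a]; ring
    · exact Finset.sum_congr rfl fun f _ => by ring
  have e2 : ∀ d, (∑ f, C.P x d f * C.γ x f a) * C.chr x b c d
      = (if d = a then C.chr x b c d else 0) - C.ℓ x a * (C.n x d * C.chr x b c d) := by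
    intro d
    rw [eq_sub_of_add_eq (h.P_γ x hx d a)]
    split_ifs <;> ring
  rw [e1, Finset.sum_congr rfl fun d _ => e2 d, Finset.sum_sub_distrib, ← Finset.mul_sum,
    h.γ_n x hx, h.K_eq hx]
  simp only [Finset.sum_ite_eq', Finset.mem_univ, if_true]
  ring

theorem ℓ_Γ (h : C.IsNull U) (hx : x ∈ U) (b c : Fin m) :
    ∑ f, C.ℓ x f * C.Γ x f b c = C.V x b c + C.ℓ2 x * C.K x b c := by
  have e1 : ∑ f, C.ℓ x f * C.Γ x f b c
      = ∑ d, (∑ f, C.P x d f * C.ℓ x f) * C.chr x b c d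
        + (∑ f, C.ℓ x f * C.n x f) * C.V x b c := by
    simp only [h.Γ_eq hx, mul_add, Finset.sum_add_distrib, Finset.mul_sum, Finset.sum_mul]
    rw [Finset.sum_comm]
    refine congrArg₂ _ ?_ ?_
    · exact Finset.sum_congr rfl fun d _ => Finset.sum_congr rfl fun f _ => by
        rw [h.symm_P x hx d f]; ring
    · exact Finset.sum_congr rfl fun f _ => by ring
  have e2 : ∀ d, (∑ f, C.P x d f * C.ℓ x f) * C.chr x b c d
      = - C.ℓ2 x * (C.n x d * C.chr x b c d) := by
    intro d
    rw [eq_neg_of_add_eq_zero_left (h.P_ℓ x hx d)]; ring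
  rw [e1, Finset.sum_congr rfl fun d _ => e2 d, ← Finset.mul_sum, h.ℓ_n x hx, h.K_eq hx]
  ring

/-- `γ_{af} R^f_{bcd}` before antisymmetrization. -/
theorem γ_Riem (h : C.IsNull U) (hx : x ∈ U) (a b c d : Fin m) :
    ∑ f, C.γ x a f * (pd c (fun y => C.Γ y f d b) x + ∑ e, C.Γ x f c e * C.Γ x e d b)
      = pd c (fun y => C.chr y d b a) x + pd c (fun y => C.K y d b * C.ℓ y a) x
        - ∑ f, C.chr x c a f * C.Γ x f d b + ∑ e, C.K x c e * C.ℓ x a * C.Γ x e d b := by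
  have dγ := fun f => diffAt_of_contDiffOn h.isOpen hx (h.smooth_γ a f)
  have dΓ := fun f => diffAt_of_contDiffOn h.isOpen hx (h.smooth_Γ f d b)
  have dK := diffAt_of_contDiffOn h.isOpen hx (h.smooth_K d b)
  have dℓ := diffAt_of_contDiffOn h.isOpen hx (h.smooth_ℓ a)
  -- The contracted identity `γ_Γ` is differentiated, so derivatives of `P`, `n` and `Γ` never have
  -- to be expanded.
  have h1 := pd_congr_on h.isOpen hx c fun y hy => h.γ_Γ hy a d b
  rw [pd_sum_mul _ _ dγ dΓ,
    pd_add _ (diffAt_of_contDiffOn h.isOpen hx (h.smooth_chr d b a)) (dK.fun_mul dℓ)] at h1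
  have h2 : ∑ f, C.Γ x f d b * pd c (fun y => C.γ y a f) x
      = ∑ f, C.chr x c a f * C.Γ x f d b + ∑ f, C.chr x c f a * C.Γ x f d b := by
    rw [← Finset.sum_add_distrib]
    exact Finset.sum_congr rfl fun f _ => by rw [h.pd_γ]; ring
  have h3 : ∑ f, C.γ x a f * ∑ e, C.Γ x f c e * C.Γ x e d b
      = ∑ e, C.chr x c e a * C.Γ x e d b + ∑ e, C.K x c e * C.ℓ x a * C.Γ x e d b := by
    rw [← Finset.sum_add_distrib]
    simp only [Finset.mul_sum]
    rw [Finset.sum_comm]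
    refine Finset.sum_congr rfl fun e _ => ?_
    rw [← add_mul, ← h.γ_Γ hx, Finset.sum_mul]
    exact Finset.sum_congr rfl fun f _ => by ring
  simp only [mul_add, Finset.sum_add_distrib]
  linear_combination h1 - h2 + h3

/-- `ℓ_f R^f_{bcd}` before antisymmetrization. -/
theorem ℓ_Riem (h : C.IsNull U) (hx : x ∈ U) (b c d : Fin m) :
    ∑ f, C.ℓ x f * (pd c (fun y => C.Γ y f d b) x + ∑ e, C.Γ x f c e * C.Γ x e d b)
      = pd c (fun y => C.V y d b) x + (C.ℓ2 x * pd c (fun y => C.K y d b) x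
          + C.K x d b * pd c C.ℓ2 x)
        - ∑ f, (pd c (fun y => C.ℓ y f) x - C.V x c f) * C.Γ x f d b
        + C.ℓ2 x * ∑ e, C.K x c e * C.Γ x e d b := by
  have dℓ := fun f => diffAt_of_contDiffOn h.isOpen hx (h.smooth_ℓ f)
  have dΓ := fun f => diffAt_of_contDiffOn h.isOpen hx (h.smooth_Γ f d b)
  have dK := diffAt_of_contDiffOn h.isOpen hx (h.smooth_K d b)
  have dℓ2 := diffAt_of_contDiffOn h.isOpen hx h.smooth_ℓ2
  have h1 := pd_congr_on h.isOpen hx c fun y hy => h.ℓ_Γ hy d b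
  rw [pd_sum_mul _ _ dℓ dΓ,
    pd_add _ (diffAt_of_contDiffOn h.isOpen hx (h.smooth_V d b)) (dℓ2.fun_mul dK),
    pd_mul _ dℓ2 dK] at h1
  have h2 : ∑ f, (pd c (fun y => C.ℓ y f) x - C.V x c f) * C.Γ x f d b
      = ∑ f, C.Γ x f d b * pd c (fun y => C.ℓ y f) x - ∑ f, C.V x c f * C.Γ x f d b := by
    rw [← Finset.sum_sub_distrib]
    exact Finset.sum_congr rfl fun f _ => by ring
  have h3 : ∑ f, C.ℓ x f * ∑ e, C.Γ x f c e * C.Γ x e d b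
      = ∑ e, C.V x c e * C.Γ x e d b + C.ℓ2 x * ∑ e, C.K x c e * C.Γ x e d b := by
    rw [Finset.mul_sum, ← Finset.sum_add_distrib]
    simp only [Finset.mul_sum]
    rw [Finset.sum_comm]
    refine Finset.sum_congr rfl fun e _ => ?_
    rw [← mul_assoc, ← add_mul, ← h.ℓ_Γ hx, Finset.sum_mul]
    exact Finset.sum_congr rfl fun f _ => by ring
  simp only [mul_add, Finset.sum_add_distrib]
  linear_combination h1 + h2 + h3

/-- The correction terms in `B` cancel the derivatives of `K ℓ` in `γ_{af} R^f_{bcd}`. In the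
derivative of `K ℓ` the factor `ℓ_e Γ^e` equals `V + ℓ⁽²⁾ K`; its `ℓ⁽²⁾ K K` part cancels the last
term of `B`, and only `V K` survives. -/
theorem B_eq_aux (h : C.IsNull U) (hx : x ∈ U) (a b c d : Fin m) :
    C.B x a b c d = pd c (fun y => C.chr y d b a) x - pd d (fun y => C.chr y c b a) x
      - (∑ f, C.chr x c a f * C.Γ x f d b - C.V x c a * C.K x d b)
      + (∑ f, C.chr x d a f * C.Γ x f c b - C.V x d a * C.K x c b) := by
  have h1 := h.γ_Riem hx a b c d
  have h2 := h.γ_Riem hx a b d c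
  have l1 := h.ℓ_Γ hx d a
  have l2 := h.ℓ_Γ hx c a
  have hR : ∑ f, C.γ x a f * C.Riem x f b c d
      = ∑ f, C.γ x a f * (pd c (fun y => C.Γ y f d b) x + ∑ e, C.Γ x f c e * C.Γ x e d b)
        - ∑ f, C.γ x a f * (pd d (fun y => C.Γ y f c b) x + ∑ e, C.Γ x f d e * C.Γ x e c b) := by
    rw [← Finset.sum_sub_distrib]
    refine Finset.sum_congr rfl fun f _ => ?_
    unfold Riem
    rw [Finset.sum_sub_distrib]
    ring
  have hN : ∀ c d, C.nabla₃ (fun y i j k => C.K y i j * C.ℓ y k) x d c b a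
      = pd d (fun y => C.K y c b * C.ℓ y a) x - ∑ e, C.Γ x e d c * (C.K x e b * C.ℓ x a)
        - ∑ e, C.K x c e * C.ℓ x a * C.Γ x e d b
        - C.K x c b * ∑ e, C.ℓ x e * C.Γ x e d a := by
    intro c d
    unfold nabla₃
    rw [Finset.sum_add_distrib, Finset.sum_add_distrib, Finset.mul_sum]
    rw [Finset.sum_congr rfl fun e _ => mul_comm (C.Γ x e d b) _]
    rw [Finset.sum_congr rfl fun e _ =>
      show C.Γ x e d a * (C.K x c b * C.ℓ x e) = C.K x c b * (C.ℓ x e * C.Γ x e d a) by ring]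
    ring
  have hs : ∑ e, C.Γ x e d c * (C.K x e b * C.ℓ x a)
      = ∑ e, C.Γ x e c d * (C.K x e b * C.ℓ x a) :=
    Finset.sum_congr rfl fun e _ => by rw [h.symm_Γ hx]
  unfold B
  rw [hR, hN, hN, h.symm_K hx b c, h.symm_K hx b d]
  linear_combination h1 - h2 - C.K x c b * l1 + C.K x d b * l2 - hs

/-- The term `ℓ⁽²⁾ ∇̄K` cancels all derivatives of `K`, and the last term of `A` cancels half of `K
dℓ⁽²⁾`; the other half accounts for the entry `½ dℓ⁽²⁾` of `W`. -/
theorem A_eq_aux (h : C.IsNull U) (hx : x ∈ U) (b c d : Fin m) :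
    C.A x b c d = pd c (fun y => C.V y d b) x - pd d (fun y => C.V y c b) x
      - (∑ f, (pd c (fun y => C.ℓ y f) x - C.V x c f) * C.Γ x f d b
        - (1 / 2) * pd c C.ℓ2 x * C.K x d b)
      + (∑ f, (pd d (fun y => C.ℓ y f) x - C.V x d f) * C.Γ x f c b
        - (1 / 2) * pd d C.ℓ2 x * C.K x c b) := by
  have h1 := h.ℓ_Riem hx b c d
  have h2 := h.ℓ_Riem hx b d c
  have hR : ∑ f, C.ℓ x f * C.Riem x f b c d
      = ∑ f, C.ℓ x f * (pd c (fun y => C.Γ y f d b) x + ∑ e, C.Γ x f c e * C.Γ x e d b)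
        - ∑ f, C.ℓ x f * (pd d (fun y => C.Γ y f c b) x + ∑ e, C.Γ x f d e * C.Γ x e c b) := by
    rw [← Finset.sum_sub_distrib]
    refine Finset.sum_congr rfl fun f _ => ?_
    unfold Riem
    rw [Finset.sum_sub_distrib]
    ring
  have hN : ∀ c d, C.nabla₂ C.K x d c b
      = pd d (fun y => C.K y c b) x - ∑ e, C.Γ x e d c * C.K x e b
        - ∑ e, C.K x c e * C.Γ x e d b := by
    intro c d
    unfold nabla₂
    rw [Finset.sum_add_distrib, Finset.sum_congr rfl fun e _ => mul_comm (C.Γ x e d b) _]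
    ring
  have hs : ∑ e, C.Γ x e d c * C.K x e b = ∑ e, C.Γ x e c d * C.K x e b :=
    Finset.sum_congr rfl fun e _ => by rw [h.symm_Γ hx]
  unfold A
  rw [hR, hN, hN, h.symm_K hx b c, h.symm_K hx b d]
  linear_combination h1 - h2 - C.ℓ2 x * hs

end IsNull
end Components

theorem pd_comm {f : Model m → ℝ} {x : Model m} {U : Set (Model m)} (hU : IsOpen U) (hx : x ∈ U)
    (hf : ContDiffOn ℝ ∞ f U) (a b : Fin m) : pd a (pd b f) x = pd b (pd a f) x := by
  have hd : DifferentiableAt ℝ (fderiv ℝ f) x :=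
    ((hf.fderiv_of_isOpen hU (m := ∞) le_rfl).contDiffAt (hU.mem_nhds hx)).differentiableAt
      (by simp)
  have key : ∀ v w : Model m, fderiv ℝ (fun y => fderiv ℝ f y v) x w = fderiv ℝ (fderiv ℝ f) x w v := by
    intro v w
    rw [fderiv_clm_apply hd (differentiableAt_const v)]
    simp
  unfold pd
  rw [key, key]
  refine ((hf.contDiffAt (hU.mem_nhds hx)).isSymmSndFDerivAt ?_).eq _ _
  rw [minSmoothness_of_isRCLikeNormedField]
  exact WithTop.coe_le_coe.2 le_top

-- The form `𝓐^♯` on covectors and its gauge invariance.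

/-- The bilinear form `P(α, β) + a n(β) + b n(α)` on covectors `(α, a)`, `(β, b)` of `ℝ^m × ℝ`. -/
def coform (P : Fin m → Fin m → ℝ) (n : Fin m → ℝ) :
    ((Fin m → ℝ) × ℝ) →ₗ[ℝ] ((Fin m → ℝ) × ℝ) →ₗ[ℝ] ℝ :=
  LinearMap.mk₂ ℝ
    (fun p q => ∑ a, ∑ b, P a b * p.1 a * q.1 b + p.2 * ∑ b, n b * q.1 b + q.2 * ∑ a, n a * p.1 a)
    (by intro p p' q; simp only [Prod.fst_add, Prod.snd_add, Pi.add_apply, mul_add, add_mul,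
          Finset.sum_add_distrib]; ring)
    (by intro c p q; simp only [Prod.smul_fst, Prod.smul_snd, Pi.smul_apply, smul_eq_mul, mul_add,
          Finset.mul_sum]
        refine congrArg₂ _ (congrArg₂ _ ?_ ?_) ?_
        · exact Finset.sum_congr rfl fun _ _ => Finset.sum_congr rfl fun _ _ => by ring
        · exact Finset.sum_congr rfl fun _ _ => by ring
        · exact Finset.sum_congr rfl fun _ _ => by ring)
    (by intro p p' q; simp only [Prod.fst_add, Prod.snd_add, Pi.add_apply, mul_add, add_mul,
          Finset.sum_add_distrib]; ring)
    (by intro c p q; simp only [Prod.smul_fst, Prod.smul_snd, Pi.smul_apply, smul_eq_mul, mul_add,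
          Finset.mul_sum]
        refine congrArg₂ _ (congrArg₂ _ ?_ ?_) ?_
        · exact Finset.sum_congr rfl fun _ _ => Finset.sum_congr rfl fun _ _ => by ring
        · exact Finset.sum_congr rfl fun _ _ => by ring
        · exact Finset.sum_congr rfl fun _ _ => by ring)

theorem coform_apply (P : Fin m → Fin m → ℝ) (n : Fin m → ℝ) (p q : (Fin m → ℝ) × ℝ) :
    coform P n p q = ∑ a, ∑ b, P a b * p.1 a * q.1 b + p.2 * ∑ b, n b * q.1 b
      + q.2 * ∑ a, n a * p.1 a := rfl

theorem coform_comm {P : Fin m → Fin m → ℝ} (hP : ∀ a b, P a b = P b a) (n : Fin m → ℝ)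
    (p q : (Fin m → ℝ) × ℝ) : coform P n p q = coform P n q p := by
  rw [coform_apply, coform_apply, Finset.sum_comm]
  rw [Finset.sum_congr rfl fun a _ => Finset.sum_congr rfl fun b _ =>
    show P b a * p.1 b * q.1 a = P a b * q.1 a * p.1 b by rw [hP]; ring]
  ring

/-- The action `(α, a) ↦ (α, z (a + α(ζ)))` of a gauge transformation on covectors. -/
def gaugeCov (z : ℝ) (ζ : Fin m → ℝ) (p : (Fin m → ℝ) × ℝ) : (Fin m → ℝ) × ℝ :=
  (p.1, z * (p.2 + ∑ a, ζ a * p.1 a))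

/-- The factor `z` cancels against `n' = z⁻¹ n`, and the products `α(ζ) n(β)` produced by the shift
are those subtracted in `P'`. -/
theorem coform_gaugeCov {P P' : Fin m → Fin m → ℝ} {n n' ζ : Fin m → ℝ} {z : ℝ} (hz : z ≠ 0)
    (hn : ∀ a, n' a = z⁻¹ * n a) (hP : ∀ a b, P' a b = P a b - n a * ζ b - ζ a * n b)
    (p q : (Fin m → ℝ) × ℝ) :
    coform P' n' (gaugeCov z ζ p) (gaugeCov z ζ q) = coform P n p q := by
  have h1 : ∀ r : (Fin m → ℝ) × ℝ, z * ∑ a, n' a * r.1 a = ∑ a, n a * r.1 a := by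
    intro r
    rw [Finset.mul_sum]
    refine Finset.sum_congr rfl fun a _ => ?_
    rw [hn]; field_simp
  have h2 : ∑ a, ∑ b, P' a b * p.1 a * q.1 b = ∑ a, ∑ b, P a b * p.1 a * q.1 b
      - (∑ a, n a * p.1 a) * (∑ b, ζ b * q.1 b) - (∑ a, ζ a * p.1 a) * (∑ b, n b * q.1 b) := by
    rw [Finset.sum_mul_sum, Finset.sum_mul_sum]
    simp only [← Finset.sum_sub_distrib]
    exact Finset.sum_congr rfl fun a _ => Finset.sum_congr rfl fun b _ => by rw [hP]; ring
  rw [coform_apply, coform_apply]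
  simp only [gaugeCov]
  rw [h2]
  linear_combination (p.2 + ∑ a, ζ a * p.1 a) * h1 q + (q.2 + ∑ a, ζ a * q.1 a) * h1 p

-- `A` and `B` through `𝓐^♯`, and the symmetries of `B`.

namespace Components

/-- The pair `([ab, ·], V_{ab})`. -/
def G (C : Components m) (x : Model m) (a b : Fin m) : (Fin m → ℝ) × ℝ :=
  (C.chr x a b, C.V x a b)

/-- The pair `(∂_c ℓ - V_c, ½ ∂_c ℓ⁽²⁾)`. -/
def W (C : Components m) (x : Model m) (c : Fin m) : (Fin m → ℝ) × ℝ :=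
  (fun f => pd c (fun y => C.ℓ y f) x - C.V x c f, (1 / 2) * pd c C.ℓ2 x)

/-- `coform` of the components at a point. -/
abbrev Q (C : Components m) (x : Model m) := coform (C.P x) (C.n x)

namespace IsNull

variable {C : Components m} {U : Set (Model m)} {x : Model m}

theorem symm_G (h : C.IsNull U) (hx : x ∈ U) (a b : Fin m) : C.G x a b = C.G x b a :=
  Prod.ext (funext fun d => h.symm_chr x a b d) (h.symm_V hx a b)

theorem Q_comm (h : C.IsNull U) (hx : x ∈ U) (p q : (Fin m → ℝ) × ℝ) :
    C.Q x p q = C.Q x q p :=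
  coform_comm (h.symm_P x hx) _ p q

/-- Raising `G_db` with `𝓐^♯` gives the vector `(Γ^f_db, -K_db)`, by `Γ_eq` and `K_eq`. -/
theorem Q_G (h : C.IsNull U) (hx : x ∈ U) (p : (Fin m → ℝ) × ℝ) (d b : Fin m) :
    C.Q x p (C.G x d b) = ∑ f, p.1 f * C.Γ x f d b - p.2 * C.K x d b := by
  simp only [Q, coform_apply, h.Γ_eq hx, h.K_eq hx, G, mul_add, Finset.sum_add_distrib,
    Finset.mul_sum]
  have e1 : ∑ a, ∑ c, C.P x a c * p.1 a * C.chr x d b c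
      = ∑ a, ∑ c, p.1 a * (C.P x a c * C.chr x d b c) :=
    Finset.sum_congr rfl fun _ _ => Finset.sum_congr rfl fun _ _ => by ring
  have e2 : ∑ a, C.V x d b * (C.n x a * p.1 a) = ∑ a, p.1 a * (C.n x a * C.V x d b) :=
    Finset.sum_congr rfl fun _ _ => by ring
  rw [e1, e2, ← Finset.mul_sum]
  ring

/-- The first argument is `𝓐((∂_e, 0), ·)`, so pairing by the inverse form extracts the component of
`G` along `∂_e`. In `Q_ℓℓ2_G` the same happens with `𝓐((0, 1), ·)`. -/
theorem Q_γℓ_G (h : C.IsNull U) (hx : x ∈ U) (e d b : Fin m) :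
    C.Q x (C.γ x e, C.ℓ x e) (C.G x d b) = C.chr x d b e := by
  rw [h.Q_G hx, h.γ_Γ hx]; ring

theorem Q_ℓℓ2_G (h : C.IsNull U) (hx : x ∈ U) (d b : Fin m) :
    C.Q x (C.ℓ x, C.ℓ2 x) (C.G x d b) = C.V x d b := by
  rw [h.Q_G hx, h.ℓ_Γ hx]; ring

theorem B_eq (h : C.IsNull U) (hx : x ∈ U) (a b c d : Fin m) :
    C.B x a b c d = pd c (fun y => C.chr y d b a) x - pd d (fun y => C.chr y c b a) x
      - C.Q x (C.G x c a) (C.G x d b) + C.Q x (C.G x d a) (C.G x c b) := by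
  rw [h.B_eq_aux hx, h.Q_G hx, h.Q_G hx]; rfl

theorem A_eq (h : C.IsNull U) (hx : x ∈ U) (b c d : Fin m) :
    C.A x b c d = pd c (fun y => C.V y d b) x - pd d (fun y => C.V y c b) x
      - C.Q x (C.W x c) (C.G x d b) + C.Q x (C.W x d) (C.G x c b) := by
  rw [h.A_eq_aux hx, h.Q_G hx, h.Q_G hx]; rfl

theorem pd_chr (h : C.IsNull U) (hx : x ∈ U) (c d b a : Fin m) :
    pd c (fun y => C.chr y d b a) x
      = (1 / 2) * (pd c (pd d fun y => C.γ y b a) x + pd c (pd b fun y => C.γ y d a) x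
        - pd c (pd a fun y => C.γ y d b) x) := by
  have hd : ∀ i j k, DifferentiableAt ℝ (pd i fun y => C.γ y j k) x := fun i j k =>
    diffAt_of_contDiffOn h.isOpen hx (contDiffOn_pd h.isOpen i (h.smooth_γ j k))
  unfold chr
  rw [pd_mul c (differentiableAt_const _) (((hd d b a).fun_add (hd b d a)).fun_sub (hd a d b)),
    pd_sub c ((hd d b a).fun_add (hd b d a)) (hd a d b), pd_add c (hd d b a) (hd b d a), pd_const]
  ring

/-- Symmetrizing in `a, b` turns the Christoffel terms into a commutator of second derivatives of
`γ_ab`; the quadratic terms cancel by symmetry of `Q`. -/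
theorem B_antisymm (h : C.IsNull U) (hx : x ∈ U) (a b c d : Fin m) :
    C.B x a b c d = -C.B x b a c d := by
  rw [h.B_eq hx, h.B_eq hx, h.pd_chr hx, h.pd_chr hx, h.pd_chr hx, h.pd_chr hx,
    h.Q_comm hx (C.G x c b), h.Q_comm hx (C.G x d b), h.γ_comm b a,
    pd_comm h.isOpen hx (h.smooth_γ a b) c d]
  ring

/-- As for a Riemann tensor: the second derivatives of `γ` match because they commute, the quadratic
terms because `Q` and `G` are symmetric. -/
theorem B_pair (h : C.IsNull U) (hx : x ∈ U) (a b c d : Fin m) :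
    C.B x a b c d = C.B x c d a b := by
  rw [h.B_eq hx, h.B_eq hx, h.pd_chr hx, h.pd_chr hx, h.pd_chr hx, h.pd_chr hx,
    h.symm_G hx a c, h.symm_G hx b d, h.symm_G hx b c, h.symm_G hx a d,
    h.Q_comm hx (C.G x c b), h.γ_comm b a, h.γ_comm d c, h.γ_comm b d, h.γ_comm a d,
    h.γ_comm b c, h.γ_comm a c,
    pd_comm h.isOpen hx (h.smooth_γ a b) c d, pd_comm h.isOpen hx (h.smooth_γ c d) a b,
    pd_comm h.isOpen hx (h.smooth_γ d a) c b, pd_comm h.isOpen hx (h.smooth_γ c a) d b,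
    pd_comm h.isOpen hx (h.smooth_γ d b) c a, pd_comm h.isOpen hx (h.smooth_γ c b) d a]
  ring

theorem symm_Ric (h : C.IsNull U) (hx : x ∈ U) (a b : Fin m) : C.Ric x a b = C.Ric x b a := by
  unfold Ric
  refine congrArg₂ _ ?_ (Finset.sum_congr rfl fun c _ => by ring)
  rw [Finset.sum_comm]
  exact Finset.sum_congr rfl fun c _ => Finset.sum_congr rfl fun d _ => by
    rw [h.B_pair hx, h.symm_P x hx]

end IsNull

-- Gauge transformations in one chart.

/-- On `U`, the components `C'` are the gauge transform of the components `C`. -/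
structure IsGauge (C C' : Components m) (U : Set (Model m)) (z : Model m → ℝ)
    (ζ : Model m → Fin m → ℝ) : Prop where
  smooth_z : ContDiffOn ℝ ∞ z U
  z_ne : ∀ y ∈ U, z y ≠ 0
  smooth_ζ : ∀ a, ContDiffOn ℝ ∞ (fun y => ζ y a) U
  γ_eq : C'.γ = C.γ
  ℓ_eq : ∀ y ∈ U, ∀ a, C'.ℓ y a = z y * (C.ℓ y a + ∑ b, ζ y b * C.γ y b a)
  ℓ2_eq : ∀ y ∈ U, C'.ℓ2 y = z y ^ 2 * (C.ℓ2 y + 2 * ∑ a, ζ y a * C.ℓ y a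
    + ∑ a, ζ y a * ∑ b, ζ y b * C.γ y b a)
  Y_eq : ∀ y ∈ U, ∀ a b, C'.Y y a b = z y * C.Y y a b
    + (1 / 2) * (C.ℓ y a * pd b z y + C.ℓ y b * pd a z y)
    + (1 / 2) * ∑ c, (z y * ζ y c * pd c (fun u => C.γ u a b) y
      + C.γ y c b * pd a (fun u => z u * ζ u c) y + C.γ y a c * pd b (fun u => z u * ζ u c) y)

namespace IsGauge

variable {C C' : Components m} {U : Set (Model m)} {z : Model m → ℝ} {ζ : Model m → Fin m → ℝ}
  {x : Model m}

theorem chr_eq (g : C.IsGauge C' U z ζ) : C'.chr = C.chr := by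
  unfold chr; rw [g.γ_eq]

/-- As `γ n' = 0`, the relation `Pγ + n ⊗ ℓ = 1` makes `n'` a multiple of `n`; the factor comes from
`ℓ'(n') = 1`, where the term with `ζ` drops out. -/
theorem n_eq (g : C.IsGauge C' U z ζ) (h : C.IsNull U) (h' : C'.IsNull U) (hx : x ∈ U)
    (a : Fin m) : C'.n x a = (z x)⁻¹ * C.n x a := by
  have hγ : ∀ b, ∑ c, C.γ x b c * C'.n x c = 0 := fun b => by
    have := h'.γ_n x hx b
    rwa [g.γ_eq] at this
  have hℓ : z x * ∑ c, C.ℓ x c * C'.n x c = 1 := by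
    have h1 := h'.ℓ_n x hx
    have h2 : ∑ c, (∑ b, ζ x b * C.γ x b c) * C'.n x c = 0 := by
      simp only [Finset.sum_mul]
      rw [Finset.sum_comm]
      refine Finset.sum_eq_zero fun b _ => ?_
      rw [← mul_zero (ζ x b), ← hγ b, Finset.mul_sum]
      exact Finset.sum_congr rfl fun c _ => by ring
    rw [← h1, ← add_zero (∑ c, C.ℓ x c * C'.n x c), ← h2, ← Finset.sum_add_distrib,
      Finset.mul_sum]
    exact Finset.sum_congr rfl fun c _ => by rw [g.ℓ_eq x hx]; ring
  have e : C'.n x a = ∑ c, (∑ b, C.P x a b * C.γ x b c + C.n x a * C.ℓ x c) * C'.n x c := by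
    simp [h.P_γ x hx]
  have e2 : ∑ c, (∑ b, C.P x a b * C.γ x b c + C.n x a * C.ℓ x c) * C'.n x c
      = C.n x a * ∑ c, C.ℓ x c * C'.n x c := by
    simp only [add_mul, Finset.sum_add_distrib, Finset.sum_mul]
    rw [Finset.sum_comm, Finset.sum_eq_zero, zero_add, Finset.mul_sum]
    · exact Finset.sum_congr rfl fun c _ => by ring
    · intro b _
      rw [← mul_zero (C.P x a b), ← hγ b, Finset.mul_sum]
      exact Finset.sum_congr rfl fun c _ => by ring
  have hz := g.z_ne x hx
  rw [e, e2]
  field_simp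
  linear_combination C.n x a * hℓ

theorem P_eq (g : C.IsGauge C' U z ζ) (h : C.IsNull U) (h' : C'.IsNull U) (hx : x ∈ U)
    (a b : Fin m) : C'.P x a b = C.P x a b - C.n x a * ζ x b - ζ x a * C.n x b := by
  have hz := g.z_ne x hx
  have hPγ' : ∀ c, ∑ e, C'.P x a e * C.γ x e c = (if a = c then 1 else 0) - C'.n x a * C'.ℓ x c := by
    intro c
    have := h'.P_γ x hx a c
    rw [g.γ_eq] at this
    linear_combination this
  have hPγ : ∀ c, ∑ e, C.P x b e * C.γ x e c = (if b = c then 1 else 0) - C.n x b * C.ℓ x c := by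
    intro c
    linear_combination h.P_γ x hx b c
  -- The product `P' γ P` is evaluated in two ways: `P'γ` and `γP` are each the identity up to a
  -- rank-one term, and comparing them determines `P' - P`.
  have e1 : ∑ c, (∑ e, C'.P x a e * C.γ x e c) * C.P x b c
      = ∑ e, C'.P x a e * ∑ c, C.P x b c * C.γ x c e := by
    simp only [Finset.sum_mul, Finset.mul_sum]
    rw [Finset.sum_comm]
    exact Finset.sum_congr rfl fun e _ => Finset.sum_congr rfl fun c _ => by
      rw [h.symm_γ x c e]; ring
  simp only [hPγ', hPγ, sub_mul, mul_sub, Finset.sum_sub_distrib, ite_mul, mul_ite, one_mul,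
    zero_mul, mul_one, mul_zero, Finset.sum_ite_eq, Finset.mem_univ, if_true] at e1
  have e2 : ∑ c, C'.n x a * C'.ℓ x c * C.P x b c
      = C'.n x a * z x * (∑ c, C.P x b c * C.ℓ x c + ζ x b - C.n x b * ∑ c, ζ x c * C.ℓ x c) := by
    have e3 : ∑ c, C.P x b c * ∑ d, ζ x d * C.γ x d c
        = ζ x b - C.n x b * ∑ c, ζ x c * C.ℓ x c := by
      have : ∑ c, C.P x b c * ∑ d, ζ x d * C.γ x d c
          = ∑ d, ζ x d * ∑ c, C.P x b c * C.γ x c d := by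
        simp only [Finset.mul_sum]
        rw [Finset.sum_comm]
        exact Finset.sum_congr rfl fun e _ => Finset.sum_congr rfl fun c _ => by
          rw [h.symm_γ x c e]; ring
      rw [this]
      simp only [hPγ, mul_sub, Finset.sum_sub_distrib, mul_ite, mul_one, mul_zero,
        Finset.sum_ite_eq, Finset.mem_univ, if_true, Finset.mul_sum]
      exact congrArg _ (Finset.sum_congr rfl fun c _ => by ring)
    rw [add_sub_assoc, ← e3, ← Finset.sum_add_distrib, Finset.mul_sum]
    exact Finset.sum_congr rfl fun c _ => by rw [g.ℓ_eq x hx]; ring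
  have e4 : z x * ∑ e, C'.P x a e * (C.n x b * C.ℓ x e)
      = C.n x b * (∑ e, C'.P x a e * C'.ℓ x e - z x * (ζ x a
        - C'.n x a * ∑ c, ζ x c * C'.ℓ x c)) := by
    have e3 : ∑ c, C'.P x a c * ∑ d, ζ x d * C.γ x d c
        = ζ x a - C'.n x a * ∑ c, ζ x c * C'.ℓ x c := by
      have : ∑ c, C'.P x a c * ∑ d, ζ x d * C.γ x d c
          = ∑ d, ζ x d * ∑ c, C'.P x a c * C.γ x c d := by
        simp only [Finset.mul_sum]
        rw [Finset.sum_comm]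
        exact Finset.sum_congr rfl fun e _ => Finset.sum_congr rfl fun c _ => by
          rw [h.symm_γ x c e]; ring
      rw [this]
      simp only [hPγ', mul_sub, Finset.sum_sub_distrib, mul_ite, mul_one, mul_zero,
        Finset.sum_ite_eq, Finset.mem_univ, if_true, Finset.mul_sum]
      exact congrArg _ (Finset.sum_congr rfl fun c _ => by ring)
    rw [← e3]
    simp only [Finset.mul_sum, mul_sub, ← Finset.sum_sub_distrib]
    refine Finset.sum_congr rfl fun c _ => ?_
    rw [g.ℓ_eq x hx]
    simp only [← Finset.mul_sum]
    ring
  have e5 : ∑ c, ζ x c * C'.ℓ x c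
      = z x * (∑ c, ζ x c * C.ℓ x c + ∑ a, ζ x a * ∑ b, ζ x b * C.γ x b a) := by
    rw [← Finset.sum_add_distrib, Finset.mul_sum]
    exact Finset.sum_congr rfl fun c _ => by rw [g.ℓ_eq x hx]; ring
  have p1 := h.P_ℓ x hx b
  have p2 := h'.P_ℓ x hx a
  rw [g.ℓ2_eq x hx] at p2
  rw [e5] at e4
  have hn : z x * C'.n x a = C.n x a := by
    rw [g.n_eq h h' hx]; field_simp
  rw [e2] at e1
  rw [h.symm_P x hx b a] at e1
  refine mul_left_cancel₀ hz ?_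
  linear_combination -z x * e1 + e4 + C.n x b * p2 - z x ^ 2 * C'.n x a * p1
    - z x * ζ x b * hn

theorem pd_ℓ (g : C.IsGauge C' U z ζ) (h : C.IsNull U) (hx : x ∈ U) (a b : Fin m) :
    pd a (fun y => C'.ℓ y b) x
      = z x * (pd a (fun y => C.ℓ y b) x + (∑ c, ζ x c * pd a (fun y => C.γ y c b) x
        + ∑ c, C.γ x c b * pd a (fun y => ζ y c) x))
        + (C.ℓ x b + ∑ c, ζ x c * C.γ x c b) * pd a z x := by
  have dz := diffAt_of_contDiffOn h.isOpen hx g.smooth_z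
  have dζ := fun c => diffAt_of_contDiffOn h.isOpen hx (g.smooth_ζ c)
  have dγ := fun c a => diffAt_of_contDiffOn h.isOpen hx (h.smooth_γ c a)
  have dℓ := diffAt_of_contDiffOn h.isOpen hx (h.smooth_ℓ b)
  have ds : DifferentiableAt ℝ (fun y => ∑ c, ζ y c * C.γ y c b) x :=
    DifferentiableAt.fun_sum fun c _ => (dζ c).fun_mul (dγ c b)
  rw [pd_congr_on h.isOpen hx a fun y hy => g.ℓ_eq y hy b, pd_mul a dz (dℓ.fun_add ds),
    pd_add a dℓ ds, pd_sum_mul _ _ dζ fun c => dγ c b]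

/-- The derivatives of `z` and `ζ` in `Y'` are exactly those in the symmetric derivative of `ℓ'`, so
they cancel and only derivatives of `γ` remain beside `V`. -/
theorem V_eq (g : C.IsGauge C' U z ζ) (h : C.IsNull U) (hx : x ∈ U) (a b : Fin m) :
    C'.V x a b = z x * (C.V x a b + ∑ c, ζ x c * C.chr x a b c) := by
  have dz := diffAt_of_contDiffOn h.isOpen hx g.smooth_z
  have dζ := fun c => diffAt_of_contDiffOn h.isOpen hx (g.smooth_ζ c)
  have hζ : ∀ a c, pd a (fun y => z y * ζ y c) x = z x * pd a (fun y => ζ y c) x + ζ x c * pd a z x :=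
    fun a c => pd_mul a dz (dζ c)
  have hY : ∑ c, (z x * ζ x c * pd c (fun u => C.γ u a b) x
      + C.γ x c b * pd a (fun u => z u * ζ u c) x + C.γ x a c * pd b (fun u => z u * ζ u c) x)
      = z x * ∑ c, ζ x c * pd c (fun u => C.γ u a b) x
        + z x * ∑ c, C.γ x c b * pd a (fun y => ζ y c) x + (∑ c, ζ x c * C.γ x c b) * pd a z x
        + z x * ∑ c, C.γ x c a * pd b (fun y => ζ y c) x
        + (∑ c, ζ x c * C.γ x c a) * pd b z x := by
    simp only [Finset.mul_sum, Finset.sum_mul, ← Finset.sum_add_distrib]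
    exact Finset.sum_congr rfl fun c _ => by rw [hζ, hζ, h.symm_γ x a c]; ring
  have hchr : ∑ c, ζ x c * C.chr x a b c
      = (1 / 2) * (∑ c, ζ x c * pd a (fun y => C.γ y c b) x
        + ∑ c, ζ x c * pd b (fun y => C.γ y c a) x
        - ∑ c, ζ x c * pd c (fun u => C.γ u a b) x) := by
    rw [← Finset.sum_add_distrib, ← Finset.sum_sub_distrib, Finset.mul_sum]
    refine Finset.sum_congr rfl fun c _ => ?_
    unfold chr
    rw [h.γ_comm b c, h.γ_comm a c]
    ring
  unfold V
  rw [g.Y_eq x hx, g.pd_ℓ h hx, g.pd_ℓ h hx, hY, hchr]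
  ring

theorem G_eq (g : C.IsGauge C' U z ζ) (h : C.IsNull U) (hx : x ∈ U) (a b : Fin m) :
    C'.G x a b = gaugeCov (z x) (ζ x) (C.G x a b) :=
  Prod.ext (by simp only [G, gaugeCov, g.chr_eq]) (g.V_eq h hx a b)

/-- This is the Leibniz rule for the derivative of `z(ξ + ζ^e ∂_e)`, with each vector lowered by `𝓐`
and then expressed in the new frame. -/
theorem W_eq (g : C.IsGauge C' U z ζ) (h : C.IsNull U) (hx : x ∈ U) (c : Fin m) :
    C'.W x c = gaugeCov (z x) (ζ x)
      (pd c z x • ((C.ℓ x, C.ℓ2 x) + ∑ e, ζ x e • (C.γ x e, C.ℓ x e))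
        + z x • (C.W x c + ∑ e, (pd c (fun y => ζ y e) x • (C.γ x e, C.ℓ x e)
          + ζ x e • C.G x c e))) := by
  have dz := diffAt_of_contDiffOn h.isOpen hx g.smooth_z
  have dζ := fun c => diffAt_of_contDiffOn h.isOpen hx (g.smooth_ζ c)
  have dℓ := fun a => diffAt_of_contDiffOn h.isOpen hx (h.smooth_ℓ a)
  have dℓ' : ∀ a, DifferentiableAt ℝ (fun y => C'.ℓ y a) x := fun a =>
    ((dz.fun_mul ((dℓ a).fun_add (DifferentiableAt.fun_sum fun c _ => (dζ c).fun_mul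
      (diffAt_of_contDiffOn h.isOpen hx (h.smooth_γ c a))))).congr_of_eventuallyEq
      (Filter.eventually_of_mem (h.isOpen.mem_nhds hx) fun y hy => g.ℓ_eq y hy a))
  have dℓ2 := diffAt_of_contDiffOn h.isOpen hx h.smooth_ℓ2
  set p : (Fin m → ℝ) × ℝ := pd c z x • ((C.ℓ x, C.ℓ2 x) + ∑ e, ζ x e • (C.γ x e, C.ℓ x e))
    + z x • (C.W x c + ∑ e, (pd c (fun y => ζ y e) x • (C.γ x e, C.ℓ x e)
      + ζ x e • C.G x c e)) with hp
  have h1 : ∀ f, pd c (fun y => C'.ℓ y f) x - C'.V x c f = p.1 f := by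
    intro f
    have e1 : p.1 f = pd c z x * (C.ℓ x f + ∑ e, ζ x e * C.γ x e f)
        + z x * (pd c (fun y => C.ℓ y f) x - C.V x c f
          + (∑ e, pd c (fun y => ζ y e) x * C.γ x e f + ∑ e, ζ x e * C.chr x c e f)) := by
      simp [hp, W, G, Finset.sum_add_distrib, Prod.fst_sum, Finset.sum_apply]
      ring
    have e2 : ∑ e, ζ x e * pd c (fun y => C.γ y e f) x
        = ∑ e, ζ x e * C.chr x c e f + ∑ e, ζ x e * C.chr x c f e := by
      rw [← Finset.sum_add_distrib]
      exact Finset.sum_congr rfl fun e _ => by rw [h.pd_γ]; ring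
    have e3 : ∑ e, pd c (fun y => ζ y e) x * C.γ x e f
        = ∑ e, C.γ x e f * pd c (fun y => ζ y e) x :=
      Finset.sum_congr rfl fun e _ => mul_comm _ _
    rw [g.pd_ℓ h hx, g.V_eq h hx, e1, e2, e3]
    ring
  refine Prod.ext (funext h1) ?_
  have e1 : p.2 = pd c z x * (C.ℓ2 x + ∑ e, ζ x e * C.ℓ x e)
      + z x * ((1 / 2) * pd c C.ℓ2 x + (∑ e, C.ℓ x e * pd c (fun y => ζ y e) x
        + ∑ e, ζ x e * C.V x c e)) := by
    simp [hp, W, G, Finset.sum_add_distrib, Prod.snd_sum, mul_comm]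
    ring
  -- Writing `ℓ'⁽²⁾` through `ℓ'` lets its derivative reuse that of `ℓ'`, instead of differentiating
  -- `γ(ζ, ζ)`.
  have e2 : ∀ y ∈ U, C'.ℓ2 y = z y * (z y * (C.ℓ2 y + ∑ a, ζ y a * C.ℓ y a)
      + ∑ a, ζ y a * C'.ℓ y a) := by
    intro y hy
    have : ∑ a, ζ y a * C'.ℓ y a = z y * (∑ a, ζ y a * C.ℓ y a
        + ∑ a, ζ y a * ∑ b, ζ y b * C.γ y b a) := by
      rw [← Finset.sum_add_distrib, Finset.mul_sum]
      exact Finset.sum_congr rfl fun a _ => by rw [g.ℓ_eq y hy]; ring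
    rw [g.ℓ2_eq y hy, this]
    ring
  have ds : DifferentiableAt ℝ (fun y => ∑ a, ζ y a * C.ℓ y a) x :=
    DifferentiableAt.fun_sum fun a _ => (dζ a).fun_mul (dℓ a)
  have ds' : DifferentiableAt ℝ (fun y => ∑ a, ζ y a * C'.ℓ y a) x :=
    DifferentiableAt.fun_sum fun a _ => (dζ a).fun_mul (dℓ' a)
  have e3 := pd_congr_on h.isOpen hx c e2
  rw [pd_mul c dz ((dz.fun_mul (dℓ2.fun_add ds)).fun_add ds'),
    pd_add c (dz.fun_mul (dℓ2.fun_add ds)) ds', pd_mul c dz (dℓ2.fun_add ds), pd_add c dℓ2 ds,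
    pd_sum_mul _ _ dζ dℓ, pd_sum_mul _ _ dζ dℓ'] at e3
  have e4 : ∑ a, ζ x a * p.1 a = ∑ a, ζ x a * pd c (fun y => C'.ℓ y a) x
      - z x * (∑ a, ζ x a * C.V x c a + ∑ a, ∑ e, ζ x a * (ζ x e * C.chr x c a e)) := by
    rw [← Finset.sum_add_distrib, Finset.mul_sum, ← Finset.sum_sub_distrib]
    refine Finset.sum_congr rfl fun a _ => ?_
    rw [← h1, g.V_eq h hx, ← Finset.mul_sum]
    ring
  -- The factor multiplying `∂_c z` in `pd_ℓ` is `z⁻¹ ℓ'`, whence the inverse of `z`.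
  have e5 : ∑ a, ζ x a * pd c (fun y => C'.ℓ y a) x
      = z x * (∑ a, ζ x a * pd c (fun y => C.ℓ y a) x
        + ∑ a, ∑ e, ζ x a * (ζ x e * pd c (fun y => C.γ y e a) x)
        + ∑ a, ∑ e, ζ x a * (C.γ x e a * pd c (fun y => ζ y e) x))
        + pd c z x * ∑ a, ζ x a * C'.ℓ x a * (z x)⁻¹ := by
    rw [← Finset.sum_add_distrib, ← Finset.sum_add_distrib, Finset.mul_sum, Finset.mul_sum,
      ← Finset.sum_add_distrib]
    refine Finset.sum_congr rfl fun a _ => ?_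
    rw [g.pd_ℓ h hx, g.ℓ_eq x hx, ← Finset.mul_sum, ← Finset.mul_sum]
    field_simp [g.z_ne x hx]
    ring
  have e6 : ∑ a, C'.ℓ x a * pd c (fun y => ζ y a) x
      = z x * (∑ a, C.ℓ x a * pd c (fun y => ζ y a) x
        + ∑ a, ∑ e, ζ x a * (C.γ x e a * pd c (fun y => ζ y e) x)) := by
    rw [Finset.sum_comm, ← Finset.sum_add_distrib, Finset.mul_sum]
    refine Finset.sum_congr rfl fun a _ => ?_
    rw [g.ℓ_eq x hx]
    have : ∑ e, ζ x e * (C.γ x a e * pd c (fun y => ζ y a) x)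
        = (∑ e, ζ x e * C.γ x e a) * pd c (fun y => ζ y a) x := by
      rw [Finset.sum_mul]
      exact Finset.sum_congr rfl fun e _ => by rw [h.symm_γ]; ring
    rw [this]
    ring
  have e7 : ∑ a, ∑ e, ζ x a * (ζ x e * pd c (fun y => C.γ y e a) x)
      = 2 * ∑ a, ∑ e, ζ x a * (ζ x e * C.chr x c a e) := by
    rw [two_mul]
    nth_rewrite 2 [Finset.sum_comm]
    simp only [← Finset.sum_add_distrib]
    exact Finset.sum_congr rfl fun a _ => Finset.sum_congr rfl fun e _ => by
      rw [h.pd_γ]; ring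
  have e8 : z x * ∑ a, ζ x a * C'.ℓ x a * (z x)⁻¹ = ∑ a, ζ x a * C'.ℓ x a := by
    rw [Finset.mul_sum]
    exact Finset.sum_congr rfl fun a _ => by field_simp [g.z_ne x hx]
  change (1 / 2) * pd c C'.ℓ2 x = z x * (p.2 + ∑ a, ζ x a * p.1 a)
  rw [e3, e4, e1, e6]
  rw [← e8, e5, e7]
  ring

theorem B_eq (g : C.IsGauge C' U z ζ) (h : C.IsNull U) (h' : C'.IsNull U) (hx : x ∈ U)
    (a b c d : Fin m) : C'.B x a b c d = C.B x a b c d := by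
  rw [h'.B_eq hx, h.B_eq hx, g.chr_eq]
  simp only [Q, g.G_eq h hx, coform_gaugeCov (g.z_ne x hx) (g.n_eq h h' hx) (g.P_eq h h' hx)]

/-- The derivatives of `z` and `ζ` in `∂_c V'` cancel those carried by `W'`, because `Q_ℓℓ2_G` and
`Q_γℓ_G` evaluate the latter. The rest is `z` times the formula for `A` plus `ζ` contracted with
that for `B`. -/
theorem A_eq (g : C.IsGauge C' U z ζ) (h : C.IsNull U) (h' : C'.IsNull U) (hx : x ∈ U)
    (b c d : Fin m) : C'.A x b c d = z x * (C.A x b c d + ∑ a, ζ x a * C.B x a b c d) := by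
  have key : ∀ c d, pd c (fun y => C'.V y d b) x - C'.Q x (C'.W x c) (C'.G x d b)
      = z x * (pd c (fun y => C.V y d b) x - C.Q x (C.W x c) (C.G x d b)
        + ∑ e, ζ x e * (pd c (fun y => C.chr y d b e) x - C.Q x (C.G x c e) (C.G x d b))) := by
    intro c d
    have dz := diffAt_of_contDiffOn h.isOpen hx g.smooth_z
    have dζ := fun c => diffAt_of_contDiffOn h.isOpen hx (g.smooth_ζ c)
    have dV := diffAt_of_contDiffOn h.isOpen hx (h.smooth_V d b)
    have dc := fun e => diffAt_of_contDiffOn h.isOpen hx (h.smooth_chr d b e)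
    have ds : DifferentiableAt ℝ (fun y => ∑ e, ζ y e * C.chr y d b e) x :=
      DifferentiableAt.fun_sum fun e _ => (dζ e).fun_mul (dc e)
    have e1 := pd_congr_on h.isOpen hx c fun y hy => g.V_eq h hy d b
    rw [pd_mul c dz (dV.fun_add ds), pd_add c dV ds, pd_sum_mul _ _ dζ dc] at e1
    have e2 : C'.Q x (C'.W x c) (C'.G x d b)
        = pd c z x * (C.V x d b + ∑ e, ζ x e * C.chr x d b e)
          + z x * (C.Q x (C.W x c) (C.G x d b) + (∑ e, C.chr x d b e * pd c (fun y => ζ y e) x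
            + ∑ e, ζ x e * C.Q x (C.G x c e) (C.G x d b))) := by
      simp only [Q]
      rw [g.W_eq h hx, g.G_eq h hx, coform_gaugeCov (g.z_ne x hx) (g.n_eq h h' hx) (g.P_eq h h' hx)]
      simp only [map_add, map_smul, map_sum, LinearMap.add_apply, LinearMap.smul_apply,
        LinearMap.sum_apply, smul_eq_mul, Finset.sum_add_distrib]
      have q1 := h.Q_ℓℓ2_G hx d b
      have q2 := fun e => h.Q_γℓ_G hx e d b
      simp only [Q] at q1 q2
      simp only [q1, q2]
      rw [Finset.sum_congr rfl fun e _ => mul_comm (C.chr x d b e) _]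
    rw [e1, e2]
    simp only [mul_sub, Finset.sum_sub_distrib]
    ring
  have k1 := key c d
  have k2 := key d c
  have e : ∑ a, ζ x a * C.B x a b c d
      = ∑ e, ζ x e * (pd c (fun y => C.chr y d b e) x - C.Q x (C.G x c e) (C.G x d b))
        - ∑ e, ζ x e * (pd d (fun y => C.chr y c b e) x - C.Q x (C.G x d e) (C.G x c b)) := by
    rw [← Finset.sum_sub_distrib]
    exact Finset.sum_congr rfl fun a _ => by rw [h.B_eq hx]; ring
  rw [h'.A_eq hx, h.A_eq hx, e]
  linear_combination k1 - k2

theorem Ric_eq (g : C.IsGauge C' U z ζ) (h : C.IsNull U) (h' : C'.IsNull U) (hx : x ∈ U)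
    (a b : Fin m) : C'.Ric x a b = C.Ric x a b := by
  have hz := g.z_ne x hx
  have e1 : ∑ c, ∑ d, C'.B x a c b d * C'.P x c d = ∑ c, ∑ d, C.B x a c b d * C.P x c d
      + ∑ c, ∑ d, ζ x d * C.B x d b a c * C.n x c + ∑ c, ∑ d, ζ x d * C.B x d a b c * C.n x c := by
    -- After this relabelling the two corrections of `P'` match termwise: one by antisymmetry of
    -- `B`, the other by pair symmetry followed by antisymmetry.
    rw [Finset.sum_comm (f := fun c d => ζ x d * C.B x d a b c * C.n x c)]
    simp only [← Finset.sum_add_distrib]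
    refine Finset.sum_congr rfl fun c _ => Finset.sum_congr rfl fun d _ => ?_
    rw [g.B_eq h h' hx, g.P_eq h h' hx, h.B_antisymm hx c a b d, h.B_antisymm hx d b a c,
      h.B_pair hx b d a c]
    ring
  have e2 : ∑ c, (C'.A x b a c + C'.A x a b c) * C'.n x c
      = ∑ c, (C.A x b a c + C.A x a b c) * C.n x c
        + ∑ c, ∑ d, ζ x d * C.B x d b a c * C.n x c
        + ∑ c, ∑ d, ζ x d * C.B x d a b c * C.n x c := by
    simp only [← Finset.sum_add_distrib]
    refine Finset.sum_congr rfl fun c _ => ?_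
    rw [g.A_eq h h' hx, g.A_eq h h' hx, g.n_eq h h' hx, ← Finset.sum_mul, ← Finset.sum_mul]
    field_simp
    ring
  unfold Ric
  rw [e1, e2]
  ring

theorem J_eq (g : C.IsGauge C' U z ζ) (h : C.IsNull U) (h' : C'.IsNull U) (hx : x ∈ U)
    (a : Fin m) : C'.J x a = (z x)⁻¹ * C.J x a := by
  unfold J
  rw [Finset.mul_sum]
  exact Finset.sum_congr rfl fun b _ => by rw [g.Ric_eq h h' hx, g.n_eq h h' hx]; ring

/-- The two corrections of `P'` contribute equally, as `𝓡` is symmetric, and the factor `-½` turns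
`-2 ζ^a J_a` into `ζ^a J_a`. -/
theorem H_eq (g : C.IsGauge C' U z ζ) (h : C.IsNull U) (h' : C'.IsNull U) (hx : x ∈ U) :
    C'.H x = C.H x + ∑ a, ζ x a * C.J x a := by
  have e : ∑ a, ∑ b, C'.P x a b * C'.Ric x a b = ∑ a, ∑ b, C.P x a b * C.Ric x a b
      - ∑ a, ζ x a * C.J x a - ∑ a, ζ x a * C.J x a := by
    unfold J
    simp only [Finset.mul_sum]
    nth_rewrite 3 [Finset.sum_comm]
    simp only [← Finset.sum_sub_distrib]
    refine Finset.sum_congr rfl fun b _ => Finset.sum_congr rfl fun a _ => ?_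
    rw [g.Ric_eq h h' hx, g.P_eq h h' hx, h.symm_Ric hx a b]
    ring
  unfold H
  rw [e]
  ring

end IsGauge
end Components

-- Coordinate frames and smoothness of components in a chart.

variable {M : Type*} [TopologicalSpace M] [ChartedSpace (Model m) M]

section Chart

variable {e : OpenPartialHomeomorph M (Model m)} {x : Model m}

theorem mdifferentiable_of_mem_maximalAtlas (he : e ∈ IsManifold.maximalAtlas (𝓡 m) ∞ M) :
    e.MDifferentiable (𝓡 m) 𝓘(ℝ, Model m) :=
  ⟨(contMDiffOn_of_mem_maximalAtlas he).mdifferentiableOn (by simp),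
    (contMDiffOn_symm_of_mem_maximalAtlas he).mdifferentiableOn (by simp)⟩

theorem chartDeriv_symm (he : e ∈ IsManifold.maximalAtlas (𝓡 m) ∞ M) (hx : x ∈ e.target)
    (v : Model m) : chartDeriv e x (mfderiv 𝓘(ℝ, Model m) (𝓡 m) e.symm x v) = v := by
  have h := (mdifferentiable_of_mem_maximalAtlas he).comp_symm_deriv hx
  exact congrArg (fun L => L v) h

theorem symm_chartDeriv (he : e ∈ IsManifold.maximalAtlas (𝓡 m) ∞ M) (hx : x ∈ e.target)
    (v : TangentSpace (𝓡 m) (e.symm x)) :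
    mfderiv 𝓘(ℝ, Model m) (𝓡 m) e.symm x (chartDeriv e x v) = v := by
  have h := (mdifferentiable_of_mem_maximalAtlas he).symm_comp_deriv (e.map_target hx)
  rw [e.right_inv hx] at h
  exact congrArg (fun L => L v) h

theorem coordForm_coordVec (he : e ∈ IsManifold.maximalAtlas (𝓡 m) ∞ M) (hx : x ∈ e.target)
    (a b : Fin m) : coordForm e x a (coordVec e x b) = if a = b then 1 else 0 := by
  change (chartDeriv e x (mfderiv 𝓘(ℝ, Model m) (𝓡 m) e.symm x
    (EuclideanSpace.single b (1 : ℝ) : Model m))) a = _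
  rw [chartDeriv_symm he hx]
  simp

theorem sum_single (v : Model m) : ∑ a, v a • (EuclideanSpace.single a (1 : ℝ) : Model m) = v := by
  ext b
  simp [Finset.sum_apply, Pi.single_apply]

theorem apply_eq_sum_single {ψ : Model m → ℝ} (hψ : IsLinearMap ℝ ψ) (v : Model m) :
    ψ v = ∑ a, v a * ψ (EuclideanSpace.single a (1 : ℝ)) := by
  have h := congrArg (hψ.mk' ψ) (sum_single v)
  rw [map_sum] at h
  rw [← IsLinearMap.mk'_apply hψ v, ← h]
  exact Finset.sum_congr rfl fun a _ => (hψ.mk' ψ).map_smul _ _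

theorem mfderiv_symm_eq_sum (e : OpenPartialHomeomorph M (Model m)) (x v : Model m) :
    mfderiv 𝓘(ℝ, Model m) (𝓡 m) e.symm x v = ∑ a, v a • coordVec e x a := by
  let L : Model m →L[ℝ] TangentSpace (𝓡 m) (e.symm x) := mfderiv 𝓘(ℝ, Model m) (𝓡 m) e.symm x
  change L v = ∑ a, v a • L (EuclideanSpace.single a (1 : ℝ))
  conv_lhs => rw [← sum_single v]
  rw [map_sum]
  exact Finset.sum_congr rfl fun a _ => L.map_smul _ _

theorem sum_coordForm_coordVec (he : e ∈ IsManifold.maximalAtlas (𝓡 m) ∞ M) (hx : x ∈ e.target)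
    (v : TangentSpace (𝓡 m) (e.symm x)) : ∑ a, coordForm e x a v • coordVec e x a = v :=
  (mfderiv_symm_eq_sum e x _).symm.trans (symm_chartDeriv he hx v)

variable [IsManifold (𝓡 m) ∞ M]

/-- The tangent map of the inverse chart is applied to a constant section; this makes coordinate
fields smooth, as needed to evaluate smooth forms on them. -/
theorem contMDiffOn_symm_vector (he : e ∈ IsManifold.maximalAtlas (𝓡 m) ∞ M) (v : Model m) :
    ContMDiffOn 𝓘(ℝ, Model m) ((𝓡 m).prod 𝓘(ℝ, Model m)) ∞
      (fun y => TotalSpace.mk' (Model m) (E := fun q : M => TangentSpace (𝓡 m) q) (e.symm y)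
        (mfderiv 𝓘(ℝ, Model m) (𝓡 m) e.symm y v)) e.target := by
  have h1 := (contMDiffOn_symm_of_mem_maximalAtlas he).contMDiffOn_tangentMapWithin (m := ∞)
    (by simp) e.open_target.uniqueMDiffOn
  have h2 : ContMDiffOn 𝓘(ℝ, Model m) (𝓘(ℝ, Model m).tangent) ∞
      (fun y : Model m => (⟨y, v⟩ : TangentBundle 𝓘(ℝ, Model m) (Model m))) e.target :=
    contMDiffOn_vectorSpace_iff_contDiffOn.2 contDiffOn_const
  have h3 := h1.comp h2 (fun y hy => hy)
  refine h3.congr fun y hy => ?_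
  simp only [Function.comp, tangentMapWithin, mfderivWithin_of_isOpen e.open_target hy]

theorem contDiffOn_chartDeriv (he : e ∈ IsManifold.maximalAtlas (𝓡 m) ∞ M)
    {X : ∀ p : M, TangentSpace (𝓡 m) p} (hX : SmoothVectorField X) :
    ContDiffOn ℝ ∞ (fun y => chartDeriv e y (X (e.symm y))) e.target := by
  have h1 := (contMDiffOn_of_mem_maximalAtlas he).contMDiffOn_tangentMapWithin (m := ∞)
    (by simp) e.open_source.uniqueMDiffOn
  have h2 := hX.comp_contMDiffOn (contMDiffOn_symm_of_mem_maximalAtlas he)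
  have h3 := h1.comp h2 (fun y hy => e.map_target hy)
  have h4 := ((contMDiff_snd_tangentBundle_modelSpace (Model m) 𝓘(ℝ, Model m)).comp_contMDiffOn
    h3).contDiffOn
  refine h4.congr fun y hy => ?_
  simp only [Function.comp, tangentMapWithin,
    mfderivWithin_of_isOpen e.open_source (e.map_target hy)]
  rfl

theorem contDiffOn_form (he : e ∈ IsManifold.maximalAtlas (𝓡 m) ∞ M)
    {α : ∀ p : M, TangentSpace (𝓡 m) p →L[ℝ] ℝ} (hα : SmoothOneForm α) (v : Model m) :
    ContDiffOn ℝ ∞ (fun y => α (e.symm y) (mfderiv 𝓘(ℝ, Model m) (𝓡 m) e.symm y v)) e.target := by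
  intro y hy
  have hs := contMDiffOn_symm_of_mem_maximalAtlas he y hy
  have : ContMDiffWithinAt 𝓘(ℝ, Model m) ((𝓡 m).prod 𝓘(ℝ)) ∞
      (fun y => TotalSpace.mk' ℝ (E := Bundle.Trivial M ℝ) (e.symm y)
        (α (e.symm y) (mfderiv 𝓘(ℝ, Model m) (𝓡 m) e.symm y v))) e.target y := by
    apply ContMDiffWithinAt.clm_bundle_apply (F₁ := Model m)
    · exact ContMDiffAt.comp_contMDiffWithinAt y hα.contMDiffAt hs
    · exact contMDiffOn_symm_vector he v y hy
  simp only [contMDiffWithinAt_totalSpace] at this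
  exact this.2.contDiffWithinAt

theorem contDiffOn_form₂ (he : e ∈ IsManifold.maximalAtlas (𝓡 m) ∞ M)
    {T : ∀ p : M, TangentSpace (𝓡 m) p →L[ℝ] TangentSpace (𝓡 m) p →L[ℝ] ℝ} (hT : SmoothForm₂ T)
    (v w : Model m) :
    ContDiffOn ℝ ∞ (fun y => T (e.symm y) (mfderiv 𝓘(ℝ, Model m) (𝓡 m) e.symm y v)
      (mfderiv 𝓘(ℝ, Model m) (𝓡 m) e.symm y w)) e.target := by
  intro y hy
  have hs := contMDiffOn_symm_of_mem_maximalAtlas he y hy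
  have : ContMDiffWithinAt 𝓘(ℝ, Model m) ((𝓡 m).prod 𝓘(ℝ)) ∞
      (fun y => TotalSpace.mk' ℝ (E := Bundle.Trivial M ℝ) (e.symm y)
        (T (e.symm y) (mfderiv 𝓘(ℝ, Model m) (𝓡 m) e.symm y v)
          (mfderiv 𝓘(ℝ, Model m) (𝓡 m) e.symm y w))) e.target y := by
    apply ContMDiffWithinAt.clm_bundle_apply₂ (F₁ := Model m) (F₂ := Model m)
    · exact ContMDiffAt.comp_contMDiffWithinAt y hT.contMDiffAt hs
    · exact contMDiffOn_symm_vector he v y hy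
    · exact contMDiffOn_symm_vector he w y hy
  simp only [contMDiffWithinAt_totalSpace] at this
  exact this.2.contDiffWithinAt

end Chart
-- Chart independence of the Lie derivative.
/-- The Lie derivative of a bilinear form on a normed space. -/
def modelLie {E : Type*} [NormedAddCommGroup E] [NormedSpace ℝ E] (X : E → E)
    (T : E → (E →L[ℝ] E →L[ℝ] ℝ)) (x v w : E) : ℝ :=
  fderiv ℝ T x (X x) v w + T x (fderiv ℝ X x v) w + T x v (fderiv ℝ X x w)

theorem hasFDerivAt_fun_comp {E F : Type*} [NormedAddCommGroup E] [NormedSpace ℝ E]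
    [NormedAddCommGroup F] [NormedSpace ℝ F] {T : E → F} {φ : E → E} {x : E}
    (hT : DifferentiableAt ℝ T (φ x)) (hφ : DifferentiableAt ℝ φ x) :
    HasFDerivAt (fun y => T (φ y)) ((fderiv ℝ T (φ x)).comp (fderiv ℝ φ x)) x :=
  hT.hasFDerivAt.comp x hφ.hasFDerivAt

set_option synthInstance.maxHeartbeats 200000 in
set_option maxHeartbeats 1000000 in
-- Differentiating the transformation laws of `T` and `X` produces terms with `D²φ`; those from `T`
-- cancel those from `X` because `D²φ` is symmetric.
theorem modelLie_pullback {E : Type*} [NormedAddCommGroup E] [NormedSpace ℝ E] {X₁ X₂ : E → E}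
    {T₁ T₂ : E → (E →L[ℝ] E →L[ℝ] ℝ)} {φ : E → E} {x : E}
    (hφ : ContDiffAt ℝ ∞ φ x)
    (hT : ∀ v w, ∀ᶠ y in nhds x, T₁ y v w = T₂ (φ y) (fderiv ℝ φ y v) (fderiv ℝ φ y w))
    (hX : ∀ᶠ y in nhds x, fderiv ℝ φ y (X₁ y) = X₂ (φ y))
    (dT₁ : DifferentiableAt ℝ T₁ x) (dT₂ : DifferentiableAt ℝ T₂ (φ x))
    (dX₁ : DifferentiableAt ℝ X₁ x) (dX₂ : DifferentiableAt ℝ X₂ (φ x)) (v w : E) :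
    modelLie X₁ T₁ x v w = modelLie X₂ T₂ (φ x) (fderiv ℝ φ x v) (fderiv ℝ φ x w) := by
  have dφ : DifferentiableAt ℝ φ x := hφ.differentiableAt (by simp)
  have ddφ : DifferentiableAt ℝ (fderiv ℝ φ) x :=
    (hφ.fderiv_right (m := ∞) (by simp)).differentiableAt (by simp)
  have symm : ∀ u u', fderiv ℝ (fderiv ℝ φ) x u u' = fderiv ℝ (fderiv ℝ φ) x u' u := by
    refine fun u u' => (hφ.isSymmSndFDerivAt ?_).eq _ _
    rw [minSmoothness_of_isRCLikeNormedField]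
    exact WithTop.coe_le_coe.2 le_top
  have hX' : ∀ u, fderiv ℝ (fderiv ℝ φ) x u (X₁ x) + fderiv ℝ φ x (fderiv ℝ X₁ x u)
      = fderiv ℝ X₂ (φ x) (fderiv ℝ φ x u) := by
    intro u
    have h1 := congrArg (fun L : E →L[ℝ] E => L u) (Filter.EventuallyEq.fderiv_eq hX)
    have h2 := ddφ.hasFDerivAt.clm_apply dX₁.hasFDerivAt
    have h3 := hasFDerivAt_fun_comp dX₂ dφ
    rw [h2.fderiv, h3.fderiv] at h1
    simpa [add_comm] using h1
  have hT' : ∀ u, fderiv ℝ T₁ x u v w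
      = fderiv ℝ T₂ (φ x) (fderiv ℝ φ x u) (fderiv ℝ φ x v) (fderiv ℝ φ x w)
        + T₂ (φ x) (fderiv ℝ (fderiv ℝ φ) x u v) (fderiv ℝ φ x w)
        + T₂ (φ x) (fderiv ℝ φ x v) (fderiv ℝ (fderiv ℝ φ) x u w) := by
    intro u
    have h1 := congrArg (fun L : E →L[ℝ] ℝ => L u) (Filter.EventuallyEq.fderiv_eq (hT v w))
    have c : ∀ v' : E, HasFDerivAt (fun _ : E => v') (0 : E →L[ℝ] E) x :=
      fun v' => hasFDerivAt_const v' x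
    have h2 := (dT₁.hasFDerivAt.clm_apply (c v)).clm_apply (c w)
    have h3 := hasFDerivAt_fun_comp (F := E →L[ℝ] E →L[ℝ] ℝ) dT₂ dφ
    have h4 := (h3.clm_apply (ddφ.hasFDerivAt.clm_apply (c v))).clm_apply
      (ddφ.hasFDerivAt.clm_apply (c w))
    rw [h2.fderiv, h4.fderiv] at h1
    simp at h1
    rw [h1]
    ring
  have hT0 : ∀ v w, T₁ x v w = T₂ (φ x) (fderiv ℝ φ x v) (fderiv ℝ φ x w) :=
    fun v w => (hT v w).self_of_nhds
  unfold modelLie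
  rw [hT', hT0, hT0, ← hX', ← hX', hX.self_of_nhds, symm (X₁ x) v, symm (X₁ x) w]
  simp only [map_add, add_apply]
  ring

/-- A vector field in the chart `e`. -/
def chartField (e : OpenPartialHomeomorph M (Model m)) (X : ∀ p : M, TangentSpace (𝓡 m) p)
    (x : Model m) : Model m := chartDeriv e x (X (e.symm x))

/-- A two-covariant tensor field in the chart `e`. -/
def chartForm (e : OpenPartialHomeomorph M (Model m))
    (T : ∀ p : M, TangentSpace (𝓡 m) p →L[ℝ] TangentSpace (𝓡 m) p →L[ℝ] ℝ) (x : Model m) :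
    Model m →L[ℝ] Model m →L[ℝ] ℝ :=
  pullForm (mfderiv 𝓘(ℝ, Model m) (𝓡 m) e.symm x : Model m →L[ℝ] TangentSpace (𝓡 m) (e.symm x))
    (T (e.symm x))

theorem lieDerivative_apply (X : ∀ p : M, TangentSpace (𝓡 m) p)
    (T : ∀ p : M, TangentSpace (𝓡 m) p →L[ℝ] TangentSpace (𝓡 m) p →L[ℝ] ℝ) (p : M)
    (v w : TangentSpace (𝓡 m) p) :
    lieDerivative X T p v w
      = modelLie (chartField (chartAt (Model m) p) X) (chartForm (chartAt (Model m) p) T)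
        (chartAt (Model m) p p)
        (mfderiv (𝓡 m) 𝓘(ℝ, Model m) (chartAt (Model m) p) p v)
        (mfderiv (𝓡 m) 𝓘(ℝ, Model m) (chartAt (Model m) p) p w) := rfl

section LieDerivative

variable [IsManifold (𝓡 m) ∞ M] {e : OpenPartialHomeomorph M (Model m)} {x : Model m}
  {X : ∀ p : M, TangentSpace (𝓡 m) p}
  {T : ∀ p : M, TangentSpace (𝓡 m) p →L[ℝ] TangentSpace (𝓡 m) p →L[ℝ] ℝ}

theorem differentiableAt_chartField (he : e ∈ IsManifold.maximalAtlas (𝓡 m) ∞ M)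
    (hx : x ∈ e.target) (hX : SmoothVectorField X) : DifferentiableAt ℝ (chartField e X) x :=
  ((contDiffOn_chartDeriv he hX).contDiffAt (e.open_target.mem_nhds hx)).differentiableAt (by simp)

theorem differentiableAt_chartForm (he : e ∈ IsManifold.maximalAtlas (𝓡 m) ∞ M)
    (hx : x ∈ e.target) (hT : SmoothForm₂ T) : DifferentiableAt ℝ (chartForm e T) x := by
  have h : ContDiffOn ℝ ∞ (chartForm e T) e.target :=
    contDiffOn_clm_apply.2 fun v => contDiffOn_clm_apply.2 fun w => contDiffOn_form₂ he hT v w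
  exact (h.contDiffAt (e.open_target.mem_nhds hx)).differentiableAt (by simp)

theorem modelLie_chart (he : e ∈ IsManifold.maximalAtlas (𝓡 m) ∞ M)
    {f : OpenPartialHomeomorph M (Model m)} (hf : f ∈ IsManifold.maximalAtlas (𝓡 m) ∞ M)
    (hx : x ∈ e.target) (hxf : e.symm x ∈ f.source) (hX : SmoothVectorField X) (hT : SmoothForm₂ T)
    (v w : Model m) :
    modelLie (chartField f X) (chartForm f T) (f (e.symm x))
        (mfderiv (𝓡 m) 𝓘(ℝ, Model m) f (e.symm x) (mfderiv 𝓘(ℝ, Model m) (𝓡 m) e.symm x v))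
        (mfderiv (𝓡 m) 𝓘(ℝ, Model m) f (e.symm x) (mfderiv 𝓘(ℝ, Model m) (𝓡 m) e.symm x w))
      = modelLie (chartField e X) (chartForm e T) x v w := by
  set φ : Model m → Model m := fun y => f (e.symm y) with hφ
  have hd : ∀ y ∈ e.target, e.symm y ∈ f.source → ∀ v : Model m, fderiv ℝ φ y v
      = mfderiv (𝓡 m) 𝓘(ℝ, Model m) f (e.symm y) (mfderiv 𝓘(ℝ, Model m) (𝓡 m) e.symm y v) := by
    intro y hy hyf v
    have h1 : MDifferentiableAt (𝓡 m) 𝓘(ℝ, Model m) f (e.symm y) :=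
      (mdifferentiable_of_mem_maximalAtlas hf).mdifferentiableAt hyf
    have h2 : MDifferentiableAt 𝓘(ℝ, Model m) (𝓡 m) e.symm y :=
      (mdifferentiable_of_mem_maximalAtlas he).mdifferentiableAt_symm hy
    have h3 := mfderiv_comp y h1 h2
    rw [← mfderiv_eq_fderiv]
    exact congrArg (fun L => L v) h3
  have hU : ∀ᶠ y in nhds x, y ∈ e.target ∧ e.symm y ∈ f.source := by
    refine Filter.Eventually.and (e.open_target.mem_nhds hx) ?_
    exact (e.continuousAt_symm hx).preimage_mem_nhds (f.open_source.mem_nhds hxf)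
  rw [← hd x hx hxf, ← hd x hx hxf]
  refine (modelLie_pullback (φ := φ) ?_ ?_ ?_ ?_ ?_ ?_ ?_ v w).symm
  · have h1 := (contMDiffAt_of_mem_maximalAtlas hf hxf).comp x (contMDiffAt_symm_of_mem_maximalAtlas he hx)
    exact h1.contDiffAt
  · intro v w
    filter_upwards [hU] with y hy
    have hq : f.symm (φ y) = e.symm y := f.left_inv hy.2
    have hL : ∀ u : Model m, (mfderiv 𝓘(ℝ, Model m) (𝓡 m) f.symm (φ y) (fderiv ℝ φ y u) : Model m)
        = mfderiv 𝓘(ℝ, Model m) (𝓡 m) e.symm y u := by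
      intro u
      rw [hd y hy.1 hy.2]
      have := (mdifferentiable_of_mem_maximalAtlas hf).symm_comp_deriv hy.2
      exact congrArg (fun L => L (mfderiv 𝓘(ℝ, Model m) (𝓡 m) e.symm y u)) this
    -- All tangent spaces are identified with the model space, so that the base point can be
    -- rewritten along `hq`.
    let S : M → (Model m →L[ℝ] Model m →L[ℝ] ℝ) := T
    change S (e.symm y) (mfderiv 𝓘(ℝ, Model m) (𝓡 m) e.symm y v : Model m)
      (mfderiv 𝓘(ℝ, Model m) (𝓡 m) e.symm y w : Model m)
      = S (f.symm (φ y)) (mfderiv 𝓘(ℝ, Model m) (𝓡 m) f.symm (φ y) (fderiv ℝ φ y v) : Model m)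
        (mfderiv 𝓘(ℝ, Model m) (𝓡 m) f.symm (φ y) (fderiv ℝ φ y w) : Model m)
    rw [hL, hL, hq]
  · filter_upwards [hU] with y hy
    have hq : f.symm (φ y) = e.symm y := f.left_inv hy.2
    rw [hd y hy.1 hy.2]
    have h1 := congrArg (fun q => (mfderiv (𝓡 m) 𝓘(ℝ, Model m) f q (X q) : Model m)) hq
    refine Eq.trans ?_ h1.symm
    exact congrArg (fun u => (mfderiv (𝓡 m) 𝓘(ℝ, Model m) f (e.symm y) u : Model m))
      (symm_chartDeriv he hy.1 _)
  · exact differentiableAt_chartForm he hx hT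
  · exact differentiableAt_chartForm hf (f.map_source hxf) hT
  · exact differentiableAt_chartField he hx hX
  · exact differentiableAt_chartField hf (f.map_source hxf) hX

set_option synthInstance.maxHeartbeats 200000 in
set_option maxHeartbeats 1000000 in
-- The preferred chart at `e.symm x` is exchanged for `e` by `modelLie_chart`, which gives one
-- formula valid at all points of `e.target`, so that it can be differentiated there.
theorem lieDerivative_coordVec (he : e ∈ IsManifold.maximalAtlas (𝓡 m) ∞ M) (hx : x ∈ e.target)
    (hX : SmoothVectorField X) (hT : SmoothForm₂ T) (a b : Fin m) :
    lieDerivative X T (e.symm x) (coordVec e x a) (coordVec e x b)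
      = ∑ c, (coordForm e x c (X (e.symm x))
          * pd c (fun y => T (e.symm y) (coordVec e y a) (coordVec e y b)) x
        + T (e.symm x) (coordVec e x c) (coordVec e x b)
          * pd a (fun y => coordForm e y c (X (e.symm y))) x
        + T (e.symm x) (coordVec e x a) (coordVec e x c)
          * pd b (fun y => coordForm e y c (X (e.symm y))) x) := by
  rw [lieDerivative_apply]
  refine (modelLie_chart he (IsManifold.chart_mem_maximalAtlas _) hx (mem_chart_source _ _) hX hT
    (EuclideanSpace.single a 1) (EuclideanSpace.single b 1)).trans ?_
  have dT := differentiableAt_chartForm he hx hT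
  have dX := differentiableAt_chartField he hx hX
  have hpT : ∀ c, pd c (fun y => T (e.symm y) (coordVec e y a) (coordVec e y b)) x
      = fderiv ℝ (chartForm e T) x (EuclideanSpace.single c 1) (EuclideanSpace.single a 1)
        (EuclideanSpace.single b 1) := by
    intro c
    have k : ∀ v' : Model m, HasFDerivAt (fun _ : Model m => v') (0 : Model m →L[ℝ] Model m) x :=
      fun v' => hasFDerivAt_const v' x
    have h := (dT.hasFDerivAt.clm_apply (k (EuclideanSpace.single a 1))).clm_apply
      (k (EuclideanSpace.single b 1))
    change fderiv ℝ (fun y => chartForm e T y (EuclideanSpace.single a 1)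
      (EuclideanSpace.single b 1)) x _ = _
    rw [h.fderiv]
    simp
  have hpX : ∀ a c, pd a (fun y => coordForm e y c (X (e.symm y))) x
      = (fderiv ℝ (chartField e X) x (EuclideanSpace.single a 1)) c := by
    intro a c
    have h : HasFDerivAt (fun y => (EuclideanSpace.proj c : Model m →L[ℝ] ℝ) (chartField e X y))
        ((EuclideanSpace.proj c : Model m →L[ℝ] ℝ).comp (fderiv ℝ (chartField e X) x)) x :=
      (EuclideanSpace.proj c : Model m →L[ℝ] ℝ).hasFDerivAt.comp x dX.hasFDerivAt
    change fderiv ℝ (fun y => (EuclideanSpace.proj c : Model m →L[ℝ] ℝ) (chartField e X y)) x _ = _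
    rw [h.fderiv]
    rfl
  simp only [hpT, hpX, Finset.sum_add_distrib]
  unfold modelLie
  refine congrArg₂ _ (congrArg₂ _ ?_ ?_) ?_
  · exact apply_eq_sum_single (ψ := fun u => fderiv ℝ (chartForm e T) x u
      (EuclideanSpace.single a 1) (EuclideanSpace.single b 1))
      ⟨fun u v => by rw [map_add, add_apply, add_apply], fun c u => by
        rw [map_smul, smul_apply, smul_apply]⟩ _
  · refine (apply_eq_sum_single (ψ := fun u => chartForm e T x u (EuclideanSpace.single b 1))
      ⟨fun u v => by rw [map_add, add_apply], fun c u => by rw [map_smul, smul_apply]⟩ _).trans ?_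
    exact Finset.sum_congr rfl fun c _ => mul_comm _ _
  · refine (apply_eq_sum_single (ψ := fun u => chartForm e T x (EuclideanSpace.single a 1) u)
      ⟨fun u v => by rw [map_add], fun c u => by rw [map_smul]⟩ _).trans ?_
    exact Finset.sum_congr rfl fun c _ => mul_comm _ _

end LieDerivative

-- Smooth dependence of the inverse matrix.

section Inverse

variable {E ι : Type*} [NormedAddCommGroup E] [NormedSpace ℝ E] [Fintype ι] [DecidableEq ι]
  {N : E → Matrix ι ι ℝ} {U : Set E}

theorem contDiffOn_det (hN : ∀ i j, ContDiffOn ℝ ∞ (fun y => N y i j) U) :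
    ContDiffOn ℝ ∞ (fun y => (N y).det) U := by
  simp only [Matrix.det_apply']
  exact ContDiffOn.sum fun σ _ => contDiffOn_const.mul (contDiffOn_prod fun i _ => hN (σ i) i)

/-- Cramer's rule: an entry of the inverse is a determinant divided by `det N`. -/
theorem contDiffOn_inv_entry (hN : ∀ i j, ContDiffOn ℝ ∞ (fun y => N y i j) U)
    (hdet : ∀ y ∈ U, (N y).det ≠ 0) (i j : ι) : ContDiffOn ℝ ∞ (fun y => (N y)⁻¹ i j) U := by
  simp only [Matrix.inv_def, Matrix.smul_apply, Matrix.adjugate_apply, smul_eq_mul,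
    Ring.inverse_eq_inv']
  refine ((contDiffOn_det hN).inv hdet).mul (contDiffOn_det fun k l => ?_)
  by_cases hk : k = j
  · subst hk
    simp only [Matrix.updateRow_self]
    exact contDiffOn_const
  · simp only [Matrix.updateRow_ne hk]
    exact hN k l

end Inverse

theorem form_eq_sum {e : OpenPartialHomeomorph M (Model m)} {x : Model m}
    (he : e ∈ IsManifold.maximalAtlas (𝓡 m) ∞ M) (hx : x ∈ e.target)
    (α : TangentSpace (𝓡 m) (e.symm x) →L[ℝ] ℝ) (v : TangentSpace (𝓡 m) (e.symm x)) :
    ∑ a, coordForm e x a v * α (coordVec e x a) = α v := by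
  conv_rhs => rw [← sum_coordForm_coordVec he hx v]
  simp only [map_sum, map_smul, smul_eq_mul]

-- From data on the manifold to components in a chart.

namespace Tensors

variable {D : Tensors m M} {p : M}

theorem 𝓐_apply (V W : TangentSpace (𝓡 m) p × ℝ) : D.𝓐 p V W
    = D.γ p V.1 W.1 + V.2 * D.ℓ p W.1 + W.2 * D.ℓ p V.1 + V.2 * W.2 * D.ℓ2 p := rfl

theorem 𝓐_sharp (h : (D.𝓐 p).Nondegenerate) (α : TangentSpace (𝓡 m) p →L[ℝ] ℝ) (a : ℝ)
    (W : TangentSpace (𝓡 m) p × ℝ) : D.𝓐 p (D.sharp p α a) W = α W.1 + a * W.2 := by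
  unfold sharp
  rw [D.𝓐_raise p h]
  simp

theorem γ_sharp (h : (D.𝓐 p).Nondegenerate) (α : TangentSpace (𝓡 m) p →L[ℝ] ℝ) (a : ℝ)
    (w : TangentSpace (𝓡 m) p) :
    D.γ p (D.sharp p α a).1 w + (D.sharp p α a).2 * D.ℓ p w = α w := by
  simpa [𝓐_apply] using 𝓐_sharp h α a (w, 0)

theorem ℓ_sharp (h : (D.𝓐 p).Nondegenerate) (α : TangentSpace (𝓡 m) p →L[ℝ] ℝ) (a : ℝ) :
    D.ℓ p (D.sharp p α a).1 + (D.sharp p α a).2 * D.ℓ2 p = a := by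
  simpa [𝓐_apply] using 𝓐_sharp h α a (0, 1)

theorem 𝓐_symm (hs : ∀ v w, D.γ p v w = D.γ p w v) (V W : TangentSpace (𝓡 m) p × ℝ) :
    D.𝓐 p V W = D.𝓐 p W V := by
  rw [𝓐_apply, 𝓐_apply, hs]; ring

theorem sharp_snd (h : (D.𝓐 p).Nondegenerate) (hs : ∀ v w, D.γ p v w = D.γ p w v)
    (α : TangentSpace (𝓡 m) p →L[ℝ] ℝ) : (D.sharp p α 0).2 = α (D.n p) := by
  have h1 := 𝓐_sharp h α 0 (D.sharp p 0 1)
  rw [𝓐_symm hs, 𝓐_sharp h] at h1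
  simpa [n] using h1

theorem P_symm (h : (D.𝓐 p).Nondegenerate) (hs : ∀ v w, D.γ p v w = D.γ p w v)
    (α β : TangentSpace (𝓡 m) p →L[ℝ] ℝ) : D.P p α β = D.P p β α := by
  have h1 := 𝓐_sharp h α 0 (D.sharp p β 0)
  rw [𝓐_symm hs, 𝓐_sharp h] at h1
  simpa [P] using h1

/-- For `v` in the radical, `𝓐((n, n⁽²⁾), (v, 0)) = 0` reads `n⁽²⁾ ℓ(v) = 0`; if `ℓ(v) = 0`, then
`(v, 0)` lies in the kernel of `𝓐`. -/
theorem n2_eq_zero (h : (D.𝓐 p).Nondegenerate) (hs : ∀ v w, D.γ p v w = D.γ p w v)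
    (hr : ∃ v : TangentSpace (𝓡 m) p, v ≠ 0 ∧ ∀ w, D.γ p v w = 0) : D.n2 p = 0 := by
  obtain ⟨v, hv, hr⟩ := hr
  have h1 := γ_sharp h 0 1 v
  rw [hs, hr, zero_add] at h1
  rcases mul_eq_zero.1 h1 with h2 | h2
  · exact h2
  · refine absurd ?_ hv
    have h3 : ((v, 0) : TangentSpace (𝓡 m) p × ℝ) = 0 :=
      h.1 _ fun W => by simp [𝓐_apply, hr, h2]
    exact congrArg Prod.fst h3

variable {e : OpenPartialHomeomorph M (Model m)}

/-- Smoothness is assumed of the covariant components only, in the chart, so the lemma serves both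
the original and the transformed data. -/
theorem isNull_components (he : e ∈ IsManifold.maximalAtlas (𝓡 m) ∞ M)
    (nondeg : ∀ p, (D.𝓐 p).Nondegenerate) (symm_γ : ∀ p v w, D.γ p v w = D.γ p w v)
    (rad : ∀ p, ∃ v : TangentSpace (𝓡 m) p, v ≠ 0 ∧ ∀ w, D.γ p v w = 0)
    (symm_Y : ∀ y ∈ e.target, ∀ a b, (D.components e).Y y a b = (D.components e).Y y b a)
    (smooth_γ : ∀ a b, ContDiffOn ℝ ∞ (fun y => (D.components e).γ y a b) e.target)
    (smooth_ℓ : ∀ a, ContDiffOn ℝ ∞ (fun y => (D.components e).ℓ y a) e.target)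
    (smooth_ℓ2 : ContDiffOn ℝ ∞ (D.components e).ℓ2 e.target)
    (smooth_Y : ∀ a b, ContDiffOn ℝ ∞ (fun y => (D.components e).Y y a b) e.target) :
    (D.components e).IsNull e.target := by
  set C := D.components e with hC
  have n2_eq : ∀ y ∈ e.target, C.n2 y = 0 := fun y _ => n2_eq_zero (nondeg _) (symm_γ _) (rad _)
  have γ_n : ∀ y ∈ e.target, ∀ a, ∑ b, C.γ y a b * C.n y b = 0 := by
    intro y hy a
    have h1 := γ_sharp (nondeg (e.symm y)) 0 1 (coordVec e y a)
    have h2 : (D.sharp (e.symm y) 0 1).2 = 0 := n2_eq y hy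
    rw [h2, zero_mul, add_zero, symm_γ] at h1
    refine Eq.trans ?_ (Eq.trans (form_eq_sum he hy (D.γ (e.symm y) (coordVec e y a))
      (D.n (e.symm y))) h1)
    exact Finset.sum_congr rfl fun b _ => mul_comm _ _
  have ℓ_n : ∀ y ∈ e.target, ∑ a, C.ℓ y a * C.n y a = 1 := by
    intro y hy
    have h1 := ℓ_sharp (nondeg (e.symm y)) 0 1
    have h2 : (D.sharp (e.symm y) 0 1).2 = 0 := n2_eq y hy
    rw [h2, zero_mul, add_zero] at h1
    refine Eq.trans ?_ (Eq.trans (form_eq_sum he hy (D.ℓ (e.symm y)) (D.n (e.symm y))) h1)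
    exact Finset.sum_congr rfl fun b _ => mul_comm _ _
  have P_ℓ : ∀ y ∈ e.target, ∀ a, ∑ b, C.P y a b * C.ℓ y b + C.ℓ2 y * C.n y a = 0 := by
    intro y hy a
    have h1 := ℓ_sharp (nondeg (e.symm y)) (coordForm e y a) 0
    rw [sharp_snd (nondeg _) (symm_γ _), ← form_eq_sum he hy, mul_comm] at h1
    exact h1
  have P_γ : ∀ y ∈ e.target, ∀ a c, ∑ b, C.P y a b * C.γ y b c + C.n y a * C.ℓ y c
      = if a = c then 1 else 0 := by
    intro y hy a c
    have h1 := γ_sharp (nondeg (e.symm y)) (coordForm e y a) 0 (coordVec e y c)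
    rw [sharp_snd (nondeg _) (symm_γ _), symm_γ, ← form_eq_sum he hy, coordForm_coordVec he hy] at h1
    refine Eq.trans (congrArg (· + _) (Finset.sum_congr rfl fun b _ => ?_)) h1
    exact congrArg (C.P y a b * ·) (symm_γ _ _ _)
  have symm_P : ∀ y ∈ e.target, ∀ a b, C.P y a b = C.P y b a := fun y _ a b =>
    P_symm (nondeg _) (symm_γ _) _ _
  have symm_γ' : ∀ y a b, C.γ y a b = C.γ y b a := fun y a b => symm_γ _ _ _
  -- `N` is the matrix of `𝓐` and `N'` that of `𝓐^♯`; since `N' = N⁻¹`, smoothness of `N` gives that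
  -- of `P` and `n`.
  let N : Model m → Matrix (Fin m ⊕ Unit) (Fin m ⊕ Unit) ℝ := fun y =>
    Matrix.fromBlocks (Matrix.of (C.γ y)) (Matrix.of fun a _ => C.ℓ y a)
      (Matrix.of fun _ b => C.ℓ y b) (Matrix.of fun _ _ => C.ℓ2 y)
  let N' : Model m → Matrix (Fin m ⊕ Unit) (Fin m ⊕ Unit) ℝ := fun y =>
    Matrix.fromBlocks (Matrix.of (C.P y)) (Matrix.of fun a _ => C.n y a)
      (Matrix.of fun _ b => C.n y b) (Matrix.of fun _ _ => C.n2 y)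
  have hNN : ∀ y ∈ e.target, N' y * N y = 1 := by
    intro y hy
    ext i j
    rcases i with i | i <;> rcases j with j | j
    · simp [N, N', Matrix.mul_apply, Matrix.one_apply, P_γ y hy]
    · simp [N, N', Matrix.mul_apply, ← P_ℓ y hy i, mul_comm]
    · simpa [N, N', Matrix.mul_apply, n2_eq y hy, symm_γ' y _ j, mul_comm] using γ_n y hy j
    · simp [N, N', Matrix.mul_apply, n2_eq y hy, ← ℓ_n y hy, mul_comm]
  have hinv : ∀ y ∈ e.target, (N y)⁻¹ = N' y := fun y hy => Matrix.inv_eq_left_inv (hNN y hy)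
  have hdet : ∀ y ∈ e.target, (N y).det ≠ 0 := by
    intro y hy h0
    have := congrArg Matrix.det (hNN y hy)
    rw [Matrix.det_mul, h0, mul_zero, Matrix.det_one] at this
    exact zero_ne_one this
  have hN : ∀ i j, ContDiffOn ℝ ∞ (fun y => N y i j) e.target := by
    rintro (i | i) (j | j)
    · exact smooth_γ i j
    · exact smooth_ℓ i
    · exact smooth_ℓ j
    · exact smooth_ℓ2
  have hN' : ∀ i j, ContDiffOn ℝ ∞ (fun y => N' y i j) e.target := fun i j =>
    (contDiffOn_inv_entry hN hdet i j).congr fun y hy => by rw [hinv y hy]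
  exact ⟨e.open_target, symm_γ', symm_Y, symm_P, γ_n, ℓ_n, P_ℓ, P_γ, n2_eq, smooth_γ, smooth_ℓ,
    smooth_ℓ2, smooth_Y, fun a b => hN' (.inl a) (.inl b), fun a => hN' (.inl a) (.inr ())⟩

variable {z : M → ℝ} {ζ : ∀ p : M, TangentSpace (𝓡 m) p}

theorem nondegenerate_gauge (hs : ∀ v w, D.γ p v w = D.γ p w v) (h : (D.𝓐 p).Nondegenerate)
    (hz0 : z p ≠ 0) : ((D.gauge z ζ).𝓐 p).Nondegenerate := by
  -- The new form is the pull-back of `𝓐` by `(v, a) ↦ (v + a z ζ, a z)`, which is invertible as `z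
  -- ≠ 0`; its inverse supplies the test vector in `left`.
  have key : ∀ V W : TangentSpace (𝓡 m) p × ℝ, (D.gauge z ζ).𝓐 p V W
      = D.𝓐 p (V.1 + (V.2 * z p) • ζ p, V.2 * z p) (W.1 + (W.2 * z p) • ζ p, W.2 * z p) := by
    intro V W
    rw [𝓐_apply, 𝓐_apply]
    simp only [gauge, map_add, map_smul, add_apply, smul_apply, smul_eq_mul]
    rw [hs V.1 (ζ p)]
    ring
  have left : ∀ V, (∀ W, (D.gauge z ζ).𝓐 p V W = 0) → V = 0 := by
    intro V hV
    have h1 : ((V.1 + (V.2 * z p) • ζ p, V.2 * z p) : TangentSpace (𝓡 m) p × ℝ) = 0 := by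
      refine h.1 _ fun W => ?_
      have h2 := hV (W.1 - W.2 • ζ p, W.2 * (z p)⁻¹)
      rw [key] at h2
      simpa [hz0] using h2
    have h2 : V.2 = 0 := by
      have := congrArg Prod.snd h1
      simpa [hz0] using this
    have h3 := congrArg Prod.fst h1
    simp only [h2, zero_mul, zero_smul, add_zero] at h3
    exact Prod.ext h3 h2
  refine ⟨left, fun V hV => left V fun W => ?_⟩
  rw [𝓐_symm (D := D.gauge z ζ) hs]
  exact hV W

variable [IsManifold (𝓡 m) ∞ M]

theorem IsCHD.isNull (hD : D.IsCHD) (he : e ∈ IsManifold.maximalAtlas (𝓡 m) ∞ M) :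
    (D.components e).IsNull e.target :=
  isNull_components he hD.nondegenerate hD.symm_γ hD.rad_ne (fun _ _ _ _ => hD.symm_Y _ _ _)
    (fun _ _ => contDiffOn_form₂ he hD.smooth_γ _ _) (fun _ => contDiffOn_form he hD.smooth_ℓ _)
    (hD.smooth_ℓ2.comp_contMDiffOn (contMDiffOn_symm_of_mem_maximalAtlas he)).contDiffOn
    (fun _ _ => contDiffOn_form₂ he hD.smooth_Y _ _)

theorem isGauge_components (hD : D.IsCHD) (hz : ContMDiff (𝓡 m) 𝓘(ℝ, ℝ) ∞ z)
    (hz0 : ∀ p, z p ≠ 0) (hζ : SmoothVectorField ζ)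
    (he : e ∈ IsManifold.maximalAtlas (𝓡 m) ∞ M) :
    (D.components e).IsGauge ((D.gauge z ζ).components e) e.target (fun y => z (e.symm y))
      (fun y a => coordForm e y a (ζ (e.symm y))) := by
  have hzζ : SmoothVectorField fun q => z q • ζ q := hz.smul_section hζ
  refine ⟨(hz.comp_contMDiffOn (contMDiffOn_symm_of_mem_maximalAtlas he)).contDiffOn,
    fun y _ => hz0 _, fun a => ?_, rfl, fun y hy a => ?_, fun y hy => ?_, fun y hy a b => ?_⟩
  · exact (EuclideanSpace.proj a : Model m →L[ℝ] ℝ).contDiff.comp_contDiffOn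
      (contDiffOn_chartDeriv he hζ)
  · have h1 := form_eq_sum he hy (D.γ (e.symm y) (coordVec e y a)) (ζ (e.symm y))
    simp only [components, gauge, smul_apply, add_apply, smul_eq_mul]
    rw [hD.symm_γ _ (ζ (e.symm y)), ← h1]
    simp only [hD.symm_γ _ (coordVec e y a)]
  · have h1 := form_eq_sum he hy (D.ℓ (e.symm y)) (ζ (e.symm y))
    have h2 := form_eq_sum he hy (D.γ (e.symm y) (ζ (e.symm y))) (ζ (e.symm y))
    have h3 : ∀ a, D.γ (e.symm y) (ζ (e.symm y)) (coordVec e y a)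
        = ∑ b, coordForm e y b (ζ (e.symm y))
          * D.γ (e.symm y) (coordVec e y b) (coordVec e y a) := by
      intro a
      rw [hD.symm_γ _ (ζ (e.symm y)),
        ← form_eq_sum he hy (D.γ (e.symm y) (coordVec e y a)) (ζ (e.symm y))]
      simp only [hD.symm_γ _ (coordVec e y a)]
    simp only [h3] at h2
    simp only [components, gauge]
    rw [← h1, ← h2]
  · have hdz : ∀ a, diff (m := m) z (e.symm y) (coordVec e y a)
        = pd a (fun y => z (e.symm y)) y := by
      intro a
      have h1 : MDifferentiableAt (𝓡 m) 𝓘(ℝ, ℝ) z (e.symm y) := hz.mdifferentiableAt (by simp)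
      have h2 : MDifferentiableAt 𝓘(ℝ, Model m) (𝓡 m) e.symm y :=
        (mdifferentiable_of_mem_maximalAtlas he).mdifferentiableAt_symm hy
      have h3 := mfderiv_comp y h1 h2
      unfold pd
      rw [← mfderiv_eq_fderiv]
      exact (congrArg (fun L => L (EuclideanSpace.single a (1 : ℝ) : Model m)) h3).symm
    have hL := lieDerivative_coordVec he hy hzζ hD.smooth_γ a b
    simp only [map_smul, smul_eq_mul] at hL
    simp only [components, gauge, symProd, add_apply, smul_apply, smul_eq_mul,
      ContinuousLinearMap.smulRight_apply, hdz]
    rw [hL]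
    ring

/-- Smoothness of `Y'` is read off the coordinate formula `Y_eq`, in which the Lie derivative is
already expanded. -/
theorem IsCHD.isNull_gauge (hD : D.IsCHD) (hz : ContMDiff (𝓡 m) 𝓘(ℝ, ℝ) ∞ z)
    (hz0 : ∀ p, z p ≠ 0) (hζ : SmoothVectorField ζ)
    (he : e ∈ IsManifold.maximalAtlas (𝓡 m) ∞ M) :
    ((D.gauge z ζ).components e).IsNull e.target := by
  have g := isGauge_components hD hz hz0 hζ he
  have h := hD.isNull he
  have szζ : ∀ c, ContDiffOn ℝ ∞ (fun u => z (e.symm u) * coordForm e u c (ζ (e.symm u))) e.target :=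
    fun c => g.smooth_z.mul (g.smooth_ζ c)
  refine isNull_components he (fun p => nondegenerate_gauge (hD.symm_γ p) (hD.nondegenerate p)
    (hz0 p)) hD.symm_γ hD.rad_ne (fun y hy a b => ?_) h.smooth_γ (fun a => ?_) ?_ (fun a b => ?_)
  · rw [g.Y_eq y hy, g.Y_eq y hy, h.symm_Y y hy a b, h.γ_comm a b]
    refine congrArg₂ _ (by ring) (congrArg _ (Finset.sum_congr rfl fun c _ => ?_))
    rw [h.symm_γ y c b, h.symm_γ y a c]
    ring
  · exact (g.smooth_z.mul ((h.smooth_ℓ a).add (ContDiffOn.sum fun b _ =>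
      (g.smooth_ζ b).mul (h.smooth_γ b a)))).congr fun y hy => g.ℓ_eq y hy a
  · exact ((g.smooth_z.pow 2).mul ((h.smooth_ℓ2.add (contDiffOn_const.mul (ContDiffOn.sum
      fun a _ => (g.smooth_ζ a).mul (h.smooth_ℓ a)))).add (ContDiffOn.sum fun a _ =>
      (g.smooth_ζ a).mul (ContDiffOn.sum fun b _ =>
      (g.smooth_ζ b).mul (h.smooth_γ b a))))).congr fun y hy => g.ℓ2_eq y hy
  · have o := h.isOpen
    exact ((((g.smooth_z.mul (h.smooth_Y a b)).add (contDiffOn_const.mul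
      (((h.smooth_ℓ a).mul (contDiffOn_pd o b g.smooth_z)).add
        ((h.smooth_ℓ b).mul (contDiffOn_pd o a g.smooth_z))))).add (contDiffOn_const.mul
      (ContDiffOn.sum fun c _ => (((szζ c).mul (contDiffOn_pd o c (h.smooth_γ a b))).add
        ((h.smooth_γ c b).mul (contDiffOn_pd o a (szζ c)))).add
        ((h.smooth_γ a c).mul (contDiffOn_pd o b (szζ c))))))).congr fun y hy => g.Y_eq y hy a b

end Tensors
end NullHypersurface
end

open NullHypersurface
-- The chart and the point of its target are arbitrary and charts cover `M`, so these component
-- identities are the tensor identities on all of `M`.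
theorem mainTheorem2 {m : ℕ} {M : Type*} [TopologicalSpace M] [ChartedSpace (Model m) M]
    [IsManifold (𝓡 m) ∞ M] (D : Tensors m M) (hD : D.IsCHD)
    (z : M → ℝ) (hz : ContMDiff (𝓡 m) 𝓘(ℝ, ℝ) ∞ z) (hz0 : ∀ p, z p ≠ 0)
    (ζ : ∀ p : M, TangentSpace (𝓡 m) p) (hζ : SmoothVectorField ζ)
    (e : OpenPartialHomeomorph M (Model m)) (he : e ∈ IsManifold.maximalAtlas (𝓡 m) ∞ M)
    (x : Model m) (hx : x ∈ e.target) :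
    ((D.gauge z ζ).components e).H x
        = (D.components e).H x + ∑ a, coordForm e x a (ζ (e.symm x)) * (D.components e).J x a ∧
      (∀ a, ((D.gauge z ζ).components e).J x a
        = (z (e.symm x))⁻¹ * (D.components e).J x a) ∧
      (∀ a b, ((D.gauge z ζ).components e).Ric x a b = (D.components e).Ric x a b) := by
  have h := hD.isNull he
  have h' := hD.isNull_gauge hz hz0 hζ he
  have g := Tensors.isGauge_components hD hz hz0 hζ he
  exact ⟨g.H_eq h h' hx, g.J_eq h h' hx, g.Ric_eq h h' hx⟩
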